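/- **Setting.** A roommates instance with incomplete lists consists of agents $N=\{1,\dots,n\}$, where each agent $i$ has a strict preference order $\succ_i$ over a subset of $N\setminus\{i\}$, the agents acceptable to $i$. Let $E$ be the set of pairs of agents that are acceptable to each other. A matching $M$ is a set of pairwise disjoint pairs in $E$; $M(i)$ is the partner of $i$, and $M(i)=i$ if $i$ is unmatched. Every agent $i$ prefers all acceptable agents to being unmatched, i.e. to $i$ itself. Agent $i$ prefers $M'$ to $M$ if $M'(i)\succ_i M(i)$. For real $k$, a matching $M$ is $k$-stable if there is no other matching $M'$ with $|\{i\in N : M'(i)\succ_i M(i)\}|\ge k$. A stable partition is a permutation $\pi$ of $N$ such that for each $i\in N$: (0) if $\pi(i)\ne i$ then $\{i,\pi(i)\}\in E$; (1) if $\pi(i)\neq\pi^{-1}(i)$ then $\pi(i)\succ_i\pi^{-1}(i)$; (2) for each $j$ with $\{i,j\}\in E$, if $\pi(i)=i$ or $j\succ_i\pi^{-1}(i)$, then $\pi^{-1}(j)=i$ or $\pi^{-1}(j)\succ_j i$. Below, an odd cycle is a cycle of $\pi$ of odd length at least three, and $x$ is the number of odd cycles. Given a stable partition $\pi$ and a set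 $D$ containing exactly one vertex of each odd cycle, we say that a matching $M$ is obtained from $(\pi,D)$ if it uses only pairs $\{i,\pi(i)\}$, leaves the vertices of $D$ and the fixed points of $\pi$ unmatched, and matches all other agents; that is, $M$ is a perfect matching of each component, other than single vertices, that remains of the cycles of $\pi$ after deleting $D$. **Theorem.** In the roommates model with incomplete lists: 1. For every instance and every real $c>\frac56$ there is a $cn$-stable matching. 2. Every instance has a stable partition $\pi$. For every stable partition $\pi$ there is a set $D$ as above, and for every such $D$ there is a matching obtained from $(\pi,D)$. For every matching $M$ obtained from $(\pi,D)$ and every matching $M'$, the number of agents who prefer $M'$ to $M$ is at most $\frac n2+x$, and $\frac n2+x\le\frac56 n$. Hence $M$ is $cn$-stable for every $c>\frac56$. 3. There is a single algorithm that, given the preference lists of any instance, outputs in time polynomial in $n$ a matching $M$ that is obtained from $(\pi,D)$ for some stable partition $\pi$ and some set $D$ as above; this $M$ is $cn$-stable for all $c>\frac56$ simultaneously. (Time is counted in steps of a random access machine with unit-cost addition, subtraction, test for zero and memory access.) -/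

import Mathlib

/-! ## The roommates model with incomplete lists -/

/-- A roommates instance with agents `0, …, n - 1`: every agent has a strictly ordered, possibly
incomplete list of the other agents, the most preferred one first. -/
structure Roommates (n : ℕ) where
  pref : Fin n → List (Fin n)
  nodup : ∀ i, (pref i).Nodup
  irrefl : ∀ i, i ∉ pref i

namespace Roommates

variable {n : ℕ}

/-- Edges of the acceptability graph: each of the two agents is acceptable to the other. -/
def Edge (I : Roommates n) (i j : Fin n) : Prop :=
  j ∈ I.pref i ∧ i ∈ I.pref j

/-- Agent `i` strictly prefers `j` to `k`. Agents that are not on the list of `i` have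
`idxOf` equal to the length of the list, so they come after all acceptable agents and are not
compared with each other. This applies to `i` itself, and "`i` is assigned to `i`" means
"`i` is unmatched". -/
def Prefers (I : Roommates n) (i j k : Fin n) : Prop :=
  (I.pref i).idxOf j < (I.pref i).idxOf k

instance (I : Roommates n) (i j k : Fin n) : Decidable (I.Prefers i j k) :=
  inferInstanceAs (Decidable (_ < _))

/-- A matching, given by the partner of every agent; `partner i = i` says that `i` is unmatched. -/
@[ext]
structure Matching (I : Roommates n) where
  partner : Fin n → Fin n
  invol : ∀ i, partner (partner i) = i
  edge : ∀ i, partner i ≠ i → I.Edge i (partner i)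

/-- The set of agents who prefer `M'` to `M`. -/
def improving (I : Roommates n) (M M' : I.Matching) : Finset (Fin n) :=
  Finset.univ.filter fun i => I.Prefers i (M'.partner i) (M.partner i)

/-- `M` is `k`-stable: no other matching is preferred to `M` by at least `k` agents. -/
def IsKStable (I : Roommates n) (k : ℝ) (M : I.Matching) : Prop :=
  ¬ ∃ M' : I.Matching, M' ≠ M ∧ k ≤ ((I.improving M M').card : ℝ)

/-- Stable partitions. In `stable`, the conclusion says that `j` weakly prefers `π⁻¹ j` to `i`. -/
structure IsStablePartition (I : Roommates n) (π : Equiv.Perm (Fin n)) : Prop where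
  edge : ∀ i, π i ≠ i → I.Edge i (π i)
  prefers : ∀ i, π i ≠ π⁻¹ i → I.Prefers i (π i) (π⁻¹ i)
  stable : ∀ i j, I.Edge i j → (π i = i ∨ I.Prefers i j (π⁻¹ i)) →
    (π⁻¹ j = i ∨ I.Prefers j (π⁻¹ j) i)

/-- The cycles of `π` of odd length at least three (`cycleFactorsFinset` does not list
fixed points). -/
def oddCycles (π : Equiv.Perm (Fin n)) : Finset (Equiv.Perm (Fin n)) :=
  π.cycleFactorsFinset.filter fun σ => Odd σ.support.card

/-- `D` consists of exactly one vertex of every odd cycle of `π` of length at least three. -/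
def PicksOnePerOddCycle (π : Equiv.Perm (Fin n)) (D : Finset (Fin n)) : Prop :=
  (∀ i ∈ D, ∃ σ ∈ oddCycles π, i ∈ σ.support) ∧
    ∀ σ ∈ oddCycles π, ∃! i, i ∈ D ∧ i ∈ σ.support

/-- `M` consists of a perfect matching of each component, other than the single vertices, of the
graph that is left of the cycles of `π` when the vertices in `D` are deleted. -/
structure IsObtainedFrom (I : Roommates n) (π : Equiv.Perm (Fin n)) (D : Finset (Fin n))
    (M : I.Matching) : Prop where
  along : ∀ i, M.partner i ≠ i → M.partner i = π i ∨ M.partner i = π⁻¹ i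
  deleted : ∀ i ∈ D, M.partner i = i
  perfect : ∀ i, i ∉ D → π i ≠ i → M.partner i ≠ i

end Roommates

/-! ## Random access machines

Programs of a random access machine with natural-number variables and arrays. The arithmetic
operations are addition and truncated subtraction. All operations have unit cost; there is
no multiplication, so this is the usual unit-cost model, polynomially equivalent to Turing
machines. -/

namespace RAM

/-- The memory: variable `x` holds `var x`, and cell `k` of array `a` holds `arr a k`. -/
structure State where
  var : ℕ → ℕ
  arr : ℕ → ℕ → ℕ

inductive Expr where
  | const (k : ℕ)
  | var (x : ℕ)
  | read (a : ℕ) (e : Expr)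
  | add (e f : Expr)
  | sub (e f : Expr)

def Expr.eval (s : State) : Expr → ℕ
  | .const k => k
  | .var x => s.var x
  | .read a e => s.arr a (e.eval s)
  | .add e f => e.eval s + f.eval s
  | .sub e f => e.eval s - f.eval s

/-- The number of operations performed in an evaluation. -/
def Expr.cost : Expr → ℕ
  | .const _ => 1
  | .var _ => 1
  | .read _ e => e.cost + 1
  | .add e f => e.cost + f.cost + 1
  | .sub e f => e.cost + f.cost + 1

inductive Prog where
  | skip
  | assign (x : ℕ) (e : Expr)
  | write (a : ℕ) (e f : Expr)
  | seq (p q : Prog)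
  | ite (e : Expr) (p q : Prog)
  | loop (e : Expr) (p : Prog)

def State.setVar (s : State) (x v : ℕ) : State :=
  { s with var := Function.update s.var x v }

def State.setArr (s : State) (a k v : ℕ) : State :=
  { s with arr := Function.update s.arr a (Function.update (s.arr a) k v) }

/-- `Exec p s t s'`: the program `p`, started in state `s`, halts after `t` steps in state `s'`.
A test succeeds if the value is not zero; `loop e p` repeats `p` while `e` succeeds. -/
inductive Exec : Prog → State → ℕ → State → Prop
  | skip (s : State) : Exec .skip s 1 s
  | assign (s : State) (x : ℕ) (e : Expr) :
      Exec (.assign x e) s (e.cost + 1) (s.setVar x (e.eval s))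
  | write (s : State) (a : ℕ) (e f : Expr) :
      Exec (.write a e f) s (e.cost + f.cost + 1) (s.setArr a (e.eval s) (f.eval s))
  | seq {p q : Prog} {s s' s'' : State} {t t' : ℕ} :
      Exec p s t s' → Exec q s' t' s'' → Exec (.seq p q) s (t + t') s''
  | ite_true {e : Expr} {p q : Prog} {s s' : State} {t : ℕ} :
      e.eval s ≠ 0 → Exec p s t s' → Exec (.ite e p q) s (e.cost + 1 + t) s'
  | ite_false {e : Expr} {p q : Prog} {s s' : State} {t : ℕ} :
      e.eval s = 0 → Exec q s t s' → Exec (.ite e p q) s (e.cost + 1 + t) s'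
  | loop_done {e : Expr} {p : Prog} {s : State} :
      e.eval s = 0 → Exec (.loop e p) s (e.cost + 1) s
  | loop_step {e : Expr} {p : Prog} {s s' s'' : State} {t t' : ℕ} :
      e.eval s ≠ 0 → Exec p s t s' → Exec (.loop e p) s' t' s'' →
        Exec (.loop e p) s (e.cost + 1 + t + t') s''

end RAM

namespace Roommates

variable {n : ℕ}

/-- Cell `i * n + r` of the input table: one plus the agent in position `r` (from `0`) of the list
of agent `i`, and `0` if that list has no such position or there is no agent `i`. -/
def inputCell (I : Roommates n) (k : ℕ) : ℕ :=
  if h : k / n < n then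
    match (I.pref ⟨k / n, h⟩)[k % n]? with
    | some j => (j : ℕ) + 1
    | none => 0
  else 0

/-- The initial memory: `n` in variable `0`, the table of preference lists in array `0`, and `0`
everywhere else. -/
def inputState (I : Roommates n) : RAM.State where
  var x := if x = 0 then n else 0
  arr a k := if a = 0 then I.inputCell k else 0

/-- The final memory describes `M`: cell `i` of array `1` is the partner of agent `i`
(and is `i` if `i` is unmatched). -/
def Outputs {I : Roommates n} (s : RAM.State) (M : I.Matching) : Prop :=
  ∀ i : Fin n, s.arr 1 i = (M.partner i : ℕ)

end Roommates

/-!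
Start from the identity permutation, every agent pointing at itself, and repeatedly eliminate
*rotations*: every agent `x` has a second choice `s x`, the best agent after its successor that
prefers `x` to its own predecessor, and the map `x ↦ σ⁻¹ (s x)` permutes a set of agents that can
simultaneously move on from `σ x` to `s x`. If no agent prefers its second choice to its
predecessor then `σ` is a stable partition. Otherwise iterating the map from an offending agent
ends in a cycle, and this is a rotation unless the map undoes `σ` along it; it never does, because
the property of undoing `σ` would propagate back to the offending agent. Each elimination makes
successors worse, so there are at most about `n²` of them.

Cutting every cycle at one of its agents and pairing up the rest from there leaves one agent of
every odd cycle unmatched; these form `D`. An agent outside `D` likes its partner at least as much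
as its predecessor, so if it improves then it prefers its new partner to its predecessor. By
stability of the partition the new partner cannot do the same, so at most `n/2` agents outside `D`
improve. The agents of `D` add at most `x`, and `3x ≤ n` because the odd cycles are disjoint and
have at least three elements.
-/

section Perm

variable {α : Type*}

lemma perm_apply_inv_self (σ : Equiv.Perm α) (x : α) : σ (σ⁻¹ x) = x := σ.apply_symm_apply x

lemma perm_inv_apply_self (σ : Equiv.Perm α) (x : α) : σ⁻¹ (σ x) = x := σ.symm_apply_apply x

end Perm

section Iterate

variable {α : Type*} {f : α → α}

lemma iterate_card_mem_periodicPts [Fintype α] (f : α → α) (x : α) :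
    f^[Fintype.card α] x ∈ Function.periodicPts f := by
  obtain ⟨i, j, hij, h⟩ : ∃ i j : Fin (Fintype.card α + 1), i < j ∧ f^[i] x = f^[j] x := by
    obtain ⟨i, j, hne, h⟩ := Fintype.exists_ne_map_eq_of_card_lt
      (fun i : Fin (Fintype.card α + 1) => f^[i] x) (by simp)
    exact (lt_or_gt_of_ne hne).elim (fun h' => ⟨i, j, h', h⟩) fun h' => ⟨j, i, h', h.symm⟩
  have hij : (i : ℕ) < j := hij
  have hper : Function.IsPeriodicPt f (j - i) (f^[i] x) := by
    rw [Function.IsPeriodicPt, Function.IsFixedPt, ← Function.iterate_add_apply,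
      Nat.sub_add_cancel hij.le, h]
  have hcard : Fintype.card α = (Fintype.card α - i) + i := by omega
  rw [hcard, Function.iterate_add_apply]
  exact ⟨j - i, by omega, hper.apply_iterate _⟩

lemma bijOn_range_iterate {p : α} (hp : p ∈ Function.periodicPts f) :
    Set.BijOn f (Set.range fun k => f^[k] p) (Set.range fun k => f^[k] p) := by
  have hsub : (Set.range fun k => f^[k] p) ⊆ Function.periodicPts f := by
    rintro _ ⟨k, rfl⟩
    obtain ⟨d, hd, hper⟩ := hp
    exact ⟨d, hd, hper.apply_iterate k⟩
  refine ⟨?_, (Function.bijOn_periodicPts f).injOn.mono hsub, ?_⟩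
  · rintro _ ⟨k, rfl⟩
    exact ⟨k + 1, Function.iterate_succ_apply' f k p⟩
  · rintro _ ⟨k, rfl⟩
    obtain ⟨d, hd, hper⟩ := hp
    refine ⟨f^[k + (d - 1)] p, ⟨_, rfl⟩, ?_⟩
    rw [← Function.iterate_succ_apply' f, show (k + (d - 1)).succ = k + d by omega,
      Function.iterate_add_apply, hper.eq]

lemma exists_lt_card_iterate_eq [Fintype α] {p : α} (hp : p ∈ Function.periodicPts f) (m : ℕ) :
    ∃ k < Fintype.card α, f^[k] p = f^[m] p :=
  ⟨m % Function.minimalPeriod f p,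
    (Nat.mod_lt _ (Function.minimalPeriod_pos_of_mem_periodicPts hp)).trans_le
      Function.minimalPeriod_le_card,
    Function.iterate_mod_minimalPeriod_eq⟩

end Iterate

namespace Roommates

variable {n : ℕ}

/-- The position of `j`, counted from one, on the list of `i`, and `n + 1` if `j` is not on it. -/
def rank (I : Roommates n) (i j : Fin n) : ℕ :=
  if j ∈ I.pref i then (I.pref i).idxOf j + 1 else n + 1

lemma length_pref_le (I : Roommates n) (i : Fin n) : (I.pref i).length ≤ n := by
  simpa using (I.nodup i).length_le_card

lemma rank_pos (I : Roommates n) (i j : Fin n) : 0 < I.rank i j := by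
  unfold rank; split_ifs <;> omega

lemma rank_le_iff (I : Roommates n) {i j : Fin n} : I.rank i j ≤ n ↔ j ∈ I.pref i := by
  have hlen := I.length_pref_le i
  unfold rank
  split_ifs with h
  · have := List.idxOf_lt_length_of_mem h
    simp only [h, iff_true]
    omega
  · simp [h]

lemma rank_le (I : Roommates n) (i j : Fin n) : I.rank i j ≤ n + 1 := by
  by_cases h : j ∈ I.pref i
  · exact (I.rank_le_iff.2 h).trans n.le_succ
  · simp [rank, h]

lemma rank_self (I : Roommates n) (i : Fin n) : I.rank i i = n + 1 := by
  simp [rank, I.irrefl i]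

lemma eq_of_rank_eq (I : Roommates n) {i j k : Fin n} (hj : I.rank i j ≤ n)
    (h : I.rank i j = I.rank i k) : j = k := by
  have hj' := I.rank_le_iff.1 hj
  have hk' := I.rank_le_iff.1 (h ▸ hj)
  simp only [rank, hj', hk', if_true, Nat.add_right_cancel_iff] at h
  exact (List.idxOf_inj hj').1 h

lemma prefers_iff (I : Roommates n) {i j k : Fin n} :
    I.Prefers i j k ↔ I.rank i j < I.rank i k := by
  have hlen := I.length_pref_le i
  unfold Prefers rank
  split_ifs with hj hk hk
  · omega
  · have := List.idxOf_lt_length_of_mem hj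
    rw [List.idxOf_eq_length hk]; omega
  · have := List.idxOf_lt_length_of_mem hk
    rw [List.idxOf_eq_length hj]; omega
  · rw [List.idxOf_eq_length hj, List.idxOf_eq_length hk]; omega

lemma edge_iff (I : Roommates n) {i j : Fin n} :
    I.Edge i j ↔ I.rank i j ≤ n ∧ I.rank j i ≤ n := by
  simp only [Edge, rank_le_iff]

section Edge

variable {I : Roommates n} {i j : Fin n}

lemma Edge.symm (h : I.Edge i j) : I.Edge j i := And.symm h

lemma Edge.rank_le (h : I.Edge i j) : I.rank i j ≤ n := (I.edge_iff.1 h).1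

end Edge

/-- The rank of the successor of `i`, where a fixed point counts as better than everybody. -/
def top (I : Roommates n) (σ : Equiv.Perm (Fin n)) (i : Fin n) : ℕ :=
  if σ i = i then 0 else I.rank i (σ i)

/-- The rank of the predecessor of `i`. -/
def bot (I : Roommates n) (σ : Equiv.Perm (Fin n)) (i : Fin n) : ℕ :=
  I.rank i (σ⁻¹ i)

/-- The invariant of the elimination of rotations: nobody prefers its predecessor to its successor,
and an agent that `i` prefers to its own successor does not prefer `i` to its predecessor. -/
structure IsSemistable (I : Roommates n) (σ : Equiv.Perm (Fin n)) : Prop where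
  edge : ∀ i, σ i ≠ i → I.Edge i (σ i)
  top_le : ∀ i, I.top σ i ≤ I.bot σ i
  blocked : ∀ i j, I.Edge i j → I.rank i j < I.top σ i → I.bot σ j ≤ I.rank j i

/-- `j` comes after the successor of `x` on the list of `x` and prefers `x` to its own
predecessor. -/
structure IsCand (I : Roommates n) (σ : Equiv.Perm (Fin n)) (x j : Fin n) : Prop where
  edge : I.Edge x j
  top_lt : I.top σ x < I.rank x j
  lt_bot : I.rank j x < I.bot σ j

/-- `q` is the second choice of `x`: its best candidate, or `x` itself if there is none. -/
structure IsSecond (I : Roommates n) (σ : Equiv.Perm (Fin n)) (x q : Fin n) : Prop where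
  cand : I.IsCand σ x q ∨ q = x
  le : ∀ j, I.IsCand σ x j → I.rank x q ≤ I.rank x j

/-- The agent whose successor is the second choice of `x`: when `x` moves on to its second choice,
this agent has to move on as well. -/
def displaced (σ : Equiv.Perm (Fin n)) (s : Fin n → Fin n) (x : Fin n) : Fin n := σ⁻¹ (s x)

/-- On the whole cycle of `p` the second choice is the predecessor. -/
def IsSettled (σ : Equiv.Perm (Fin n)) (s : Fin n → Fin n) (p : Fin n) : Prop :=
  ∀ k : ℕ, s ((σ ^ k) p) = σ⁻¹ ((σ ^ k) p)

/-- A set of agents that can simultaneously move on from their successors to their second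
choices. -/
structure IsRotation (I : Roommates n) (σ : Equiv.Perm (Fin n)) (s : Fin n → Fin n)
    (Z : Set (Fin n)) : Prop where
  active : ∀ x ∈ Z, I.top σ x < I.bot σ x
  unsettled : ∀ x ∈ Z, ¬ IsSettled σ s x
  bijOn : Set.BijOn (displaced σ s) Z Z

lemma isSemistable_one (I : Roommates n) : I.IsSemistable 1 where
  edge _ h := absurd rfl h
  top_le i := by simp [top]
  blocked i j _ h := by simp [top] at h

lemma exists_isSecond (I : Roommates n) (σ : Equiv.Perm (Fin n)) (x : Fin n) :
    ∃ q, I.IsSecond σ x q := by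
  by_cases h : {j | I.IsCand σ x j}.Nonempty
  · obtain ⟨q, hq, hmin⟩ := Set.exists_min_image _ (I.rank x) (Set.toFinite _) h
    exact ⟨q, .inl hq, hmin⟩
  · exact ⟨x, .inr rfl, fun j hj => absurd ⟨j, hj⟩ h⟩

lemma inv_apply_ne {α : Type*} {σ : Equiv.Perm α} {x : α} (h : σ x ≠ x) : σ⁻¹ x ≠ x :=
  fun h' => h (Equiv.Perm.inv_eq_iff_eq.1 h').symm

lemma edge_inv {I : Roommates n} {σ : Equiv.Perm (Fin n)} (hσ : ∀ i, σ i ≠ i → I.Edge i (σ i))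
    {x : Fin n} (h : σ x ≠ x) : I.Edge x (σ⁻¹ x) := by
  have := hσ (σ⁻¹ x)
  rw [perm_apply_inv_self] at this
  exact (this (inv_apply_ne h).symm).symm

section Semistable

variable {I : Roommates n} {σ : Equiv.Perm (Fin n)} {s : Fin n → Fin n} {x q : Fin n}

lemma bot_le (x : Fin n) : I.bot σ x ≤ n + 1 := I.rank_le _ _

lemma top_of_ne (h : σ x ≠ x) : I.top σ x = I.rank x (σ x) := if_neg h

lemma bot_of_fixed (h : σ x = x) : I.bot σ x = n + 1 := by
  rw [bot, Equiv.Perm.inv_eq_iff_eq.2 h.symm, rank_self]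

lemma bot_apply (x : Fin n) : I.bot σ (σ x) = I.rank (σ x) x := by
  rw [bot, perm_inv_apply_self]

lemma IsSemistable.top_le_card (hσ : I.IsSemistable σ) (x : Fin n) : I.top σ x ≤ n := by
  by_cases h : σ x = x
  · simp [top, h]
  · exact (top_of_ne h).trans_le (hσ.edge x h).rank_le

lemma IsSemistable.eq_apply_of_rank_eq_top (hσ : I.IsSemistable σ)
    (h : I.rank x q = I.top σ x) : q = σ x := by
  have hle := hσ.top_le_card x
  have hne : σ x ≠ x := fun hx => by
    rw [top, if_pos hx] at h
    exact (I.rank_pos x q).ne' h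
  exact I.eq_of_rank_eq (h.trans_le hle) (h.trans (top_of_ne hne))

lemma IsSemistable.apply_eq_inv (hσ : I.IsSemistable σ) (h : I.bot σ x ≤ I.top σ x) :
    σ x = σ⁻¹ x :=
  (hσ.eq_apply_of_rank_eq_top (le_antisymm h (hσ.top_le x))).symm

lemma ne_of_bot_le_top (h : I.bot σ x ≤ I.top σ x) : σ x ≠ x := fun hx => by
  rw [top, if_pos hx] at h
  exact (I.rank_pos x _).not_ge h

lemma IsSemistable.top_lt_bot_of_apply (hσ : I.IsSemistable σ)
    (h : I.top σ (σ x) < I.bot σ (σ x)) : I.top σ x < I.bot σ x := by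
  by_contra! hx
  have hσσ : σ (σ x) = x := by rw [hσ.apply_eq_inv hx, perm_apply_inv_self]
  have hne : σ (σ x) ≠ σ x := by rw [hσσ]; exact (ne_of_bot_le_top hx).symm
  rw [top_of_ne hne, bot_apply, hσσ] at h
  exact h.false

lemma IsSemistable.isCand_inv (hσ : I.IsSemistable σ) (h : I.top σ x < I.bot σ x)
    (hx : σ x ≠ x) : I.IsCand σ x (σ⁻¹ x) := by
  refine ⟨edge_inv hσ.edge hx, h, ?_⟩
  have hinv : σ (σ⁻¹ x) = x := perm_apply_inv_self _ _
  have hne : σ (σ⁻¹ x) ≠ σ⁻¹ x := by rw [hinv]; exact (inv_apply_ne hx).symm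
  have hactive : I.top σ (σ⁻¹ x) < I.bot σ (σ⁻¹ x) := hσ.top_lt_bot_of_apply (by rwa [hinv])
  rwa [top_of_ne hne, hinv] at hactive

lemma IsSecond.isCand (h : I.IsSecond σ x q) (hq : q ≠ x) : I.IsCand σ x q :=
  h.cand.resolve_right hq

lemma IsSecond.isCand_of_lt_bot (h : I.IsSecond σ x q) (hq : I.rank x q < I.bot σ x) :
    I.IsCand σ x q :=
  h.isCand <| by
    rintro rfl
    exact (I.rank_self q ▸ hq).not_ge (bot_le q)

lemma IsSecond.rank_le_bot (hσ : I.IsSemistable σ) (h : I.IsSecond σ x q)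
    (hx : I.top σ x < I.bot σ x) : I.rank x q ≤ I.bot σ x := by
  by_cases hf : σ x = x
  · exact (I.rank_le _ _).trans_eq (bot_of_fixed hf).symm
  · exact h.le _ (hσ.isCand_inv hx hf)

lemma IsSecond.eq_inv (hσ : I.IsSemistable σ) (h : I.IsSecond σ x q)
    (hx : I.top σ x < I.bot σ x) (hq : I.bot σ x ≤ I.rank x q) : q = σ⁻¹ x := by
  have he : I.rank x q = I.bot σ x := (h.rank_le_bot hσ hx).antisymm hq
  by_cases hf : σ x = x
  · have hqx : q = x := h.cand.resolve_left fun hc => by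
      have := hc.edge.rank_le
      have := bot_of_fixed (I := I) hf
      omega
    rw [hqx, Equiv.Perm.eq_inv_iff_eq, hf]
  · exact I.eq_of_rank_eq (he.trans_le (edge_inv hσ.edge hf).rank_le) he

lemma IsSecond.bot_le_rank (hσ : I.IsSemistable σ) (h : I.IsSecond σ x q) {j : Fin n}
    (he : I.Edge x j) (hlt : I.rank x j < I.rank x q) : I.bot σ j ≤ I.rank j x := by
  rcases lt_trichotomy (I.rank x j) (I.top σ x) with hj | hj | hj
  · exact hσ.blocked x j he hj
  · rw [hσ.eq_apply_of_rank_eq_top hj, bot_apply]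
  · by_contra! hlt'
    exact (h.le j ⟨he, hj, hlt'⟩).not_gt hlt

lemma IsSecond.top_le_rank (hσ : I.IsSemistable σ) (h : I.IsSecond σ x q)
    (hx : I.top σ x < I.bot σ x) (hq : q ≠ x) : I.top σ q ≤ I.rank q x := by
  by_contra! hlt
  have hqx : q = σ⁻¹ x := h.eq_inv hσ hx (hσ.blocked q x (h.isCand hq).edge.symm hlt)
  have hx' : σ q = x := by rw [hqx, perm_apply_inv_self]
  rw [top_of_ne (hx' ▸ hq.symm), hx'] at hlt
  exact hlt.false

lemma IsSecond.apply_eq_of_eq_inv (hσ : I.IsSemistable σ) (hs : ∀ x, I.IsSecond σ x (s x))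
    (hx : I.top σ x < I.bot σ x) (hq : s (s x) = σ⁻¹ (s x)) : σ (s x) = x := by
  by_cases hqx : s x = x
  · rw [hqx] at hq
    rw [hq, perm_apply_inv_self]
  · have hc := (hs x).isCand hqx
    have hlt : I.rank (s x) x < I.rank (s x) (s (s x)) := hq ▸ hc.lt_bot
    have hle := (hs (s x)).bot_le_rank hσ hc.edge.symm hlt
    rw [(hs x).eq_inv hσ hx hle, perm_apply_inv_self]

lemma IsSecond.fixed (hσ : I.IsSemistable σ) (h : I.IsSecond σ x x)
    (hx : I.top σ x < I.bot σ x) : σ x = x := by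
  by_contra hf
  have hle := h.le _ (hσ.isCand_inv hx hf)
  rw [rank_self] at hle
  exact (hle.trans (edge_inv hσ.edge hf).rank_le).not_gt n.lt_succ_self

lemma IsSettled.apply (h : IsSettled σ s x) : IsSettled σ s (σ x) := fun k => by
  have := h (k + 1)
  rwa [pow_succ, Equiv.Perm.mul_apply] at this

lemma IsSettled.of_displaced (hσ : I.IsSemistable σ) (hs : ∀ x, I.IsSecond σ x (s x))
    (hx : I.top σ x < I.bot σ x) (h : IsSettled σ s (displaced σ s x)) : IsSettled σ s x := by
  have hsx : IsSettled σ s (s x) := by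
    have := h.apply
    rwa [displaced, perm_apply_inv_self] at this
  have := hsx.apply
  rwa [IsSecond.apply_eq_of_eq_inv hσ hs hx (hsx 0)] at this

lemma IsSettled.of_second_eq_self (hσ : I.IsSemistable σ) (hs : ∀ x, I.IsSecond σ x (s x))
    (hx : I.top σ x < I.bot σ x) (h : s x = x) : IsSettled σ s x := fun k => by
  have hfix : σ x = x := IsSecond.fixed hσ (by simpa only [h] using hs x) hx
  rw [Equiv.Perm.pow_apply_eq_self_of_apply_eq_self hfix, h, Equiv.Perm.eq_inv_iff_eq, hfix]

lemma IsSemistable.top_lt_bot_displaced (hσ : I.IsSemistable σ)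
    (hs : ∀ x, I.IsSecond σ x (s x)) (hx : I.top σ x < I.bot σ x) :
    I.top σ (displaced σ s x) < I.bot σ (displaced σ s x) := by
  apply hσ.top_lt_bot_of_apply
  rw [displaced, perm_apply_inv_self]
  by_cases h : s x = x
  · rwa [h]
  · exact ((hs x).top_le_rank hσ hx h).trans_lt ((hs x).isCand h).lt_bot

lemma IsStablePartition.bot_le_rank_second (hσ : I.IsStablePartition σ)
    (h : I.IsSecond σ x q) : I.bot σ x ≤ I.rank x q := by
  by_contra! hlt
  have hc := h.isCand_of_lt_bot hlt
  rcases hσ.stable x q hc.edge (.inr (I.prefers_iff.2 hlt)) with hq | hq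
  · exact hc.lt_bot.ne (by rw [bot, hq])
  · exact hc.lt_bot.asymm (I.prefers_iff.1 hq)

lemma IsSemistable.isStablePartition (hσ : I.IsSemistable σ) (hs : ∀ x, I.IsSecond σ x (s x))
    (h : ∀ x, I.bot σ x ≤ I.rank x (s x)) : I.IsStablePartition σ where
  edge := hσ.edge
  prefers i hi := by
    have hne : σ i ≠ i := fun hf => hi (by rw [hf, Equiv.Perm.eq_inv_iff_eq, hf])
    have hle := hσ.top_le i
    rw [top_of_ne hne] at hle
    exact I.prefers_iff.2 (hle.lt_of_ne fun he => hi (I.eq_of_rank_eq (hσ.edge i hne).rank_le he))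
  stable i j he hij := by
    have hlt : I.rank i j < I.bot σ i := by
      rcases hij with hf | hp
      · rw [bot_of_fixed hf]
        exact Nat.lt_succ_of_le he.rank_le
      · exact I.prefers_iff.1 hp
    have hle : I.bot σ j ≤ I.rank j i := (hs i).bot_le_rank hσ he (hlt.trans_le (h i))
    rcases hle.eq_or_lt with heq | hlt'
    · exact .inl (I.eq_of_rank_eq he.symm.rank_le heq.symm).symm
    · exact .inr (I.prefers_iff.2 hlt')

end Semistable

section Rotation

variable {I : Roommates n} {σ : Equiv.Perm (Fin n)} {s : Fin n → Fin n} {Z : Set (Fin n)}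
  {x : Fin n}

open Classical in
/-- The permutation in which the agents of a rotation have moved on to their second choices. -/
noncomputable def IsRotation.eliminate (hZ : I.IsRotation σ s Z) : Equiv.Perm (Fin n) :=
  σ * Equiv.Perm.ofSubtype (hZ.bijOn.equiv _)

lemma IsRotation.eliminate_of_mem (hZ : I.IsRotation σ s Z) (hx : x ∈ Z) :
    hZ.eliminate x = s x := by
  classical
  rw [eliminate, Equiv.Perm.mul_apply, Equiv.Perm.ofSubtype_apply_of_mem _ hx]
  exact perm_apply_inv_self _ _

lemma IsRotation.eliminate_of_notMem (hZ : I.IsRotation σ s Z) (hx : x ∉ Z) :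
    hZ.eliminate x = σ x := by
  classical
  rw [eliminate, Equiv.Perm.mul_apply, Equiv.Perm.ofSubtype_apply_of_not_mem _ hx]

lemma IsRotation.second_ne_self (hσ : I.IsSemistable σ) (hs : ∀ x, I.IsSecond σ x (s x))
    (hZ : I.IsRotation σ s Z) (hx : x ∈ Z) : s x ≠ x := fun h =>
  hZ.unsettled x hx (.of_second_eq_self hσ hs (hZ.active x hx) h)

lemma IsRotation.isCand (hσ : I.IsSemistable σ) (hs : ∀ x, I.IsSecond σ x (s x))
    (hZ : I.IsRotation σ s Z) (hx : x ∈ Z) : I.IsCand σ x (s x) :=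
  (hs x).isCand (hZ.second_ne_self hσ hs hx)

lemma IsRotation.second_ne_inv (hσ : I.IsSemistable σ) (hs : ∀ x, I.IsSecond σ x (s x))
    (hZ : I.IsRotation σ s Z) (hx : x ∈ Z) (hx' : σ⁻¹ x ∈ Z) : s x ≠ σ⁻¹ x := by
  intro h
  have hpow : ∀ k : ℕ, (σ ^ k) x ∈ Z ∧ σ⁻¹ ((σ ^ k) x) ∈ Z ∧
      s ((σ ^ k) x) = σ⁻¹ ((σ ^ k) x) := fun k => by
    induction k with
    | zero => exact ⟨hx, hx', h⟩
    | succ k ih =>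
      obtain ⟨hmem, hpred, hback⟩ := ih
      obtain ⟨u, hu, hsu⟩ := hZ.bijOn.surjOn hpred
      have hsu : s u = (σ ^ k) x := σ⁻¹.injective hsu
      have hσu : σ (s u) = u := IsSecond.apply_eq_of_eq_inv hσ hs (hZ.active u hu) (hsu ▸ hback)
      rw [pow_succ', Equiv.Perm.mul_apply, ← hsu, hσu]
      exact ⟨hu, by rwa [← hσu, perm_inv_apply_self, hsu],
        by rw [Equiv.Perm.eq_inv_iff_eq, hσu]⟩
  exact hZ.unsettled x hx fun k => (hpow k).2.2

lemma IsRotation.rank_second_second_le (hσ : I.IsSemistable σ)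
    (hs : ∀ x, I.IsSecond σ x (s x)) (hZ : I.IsRotation σ s Z) (hx : x ∈ Z) (hsx : s x ∈ Z) :
    I.rank (s x) (s (s x)) ≤ I.rank (s x) x := by
  by_contra! hlt
  have hle := (hs (s x)).bot_le_rank hσ (hZ.isCand hσ hs hx).edge.symm hlt
  have heq : s x = σ⁻¹ x := (hs x).eq_inv hσ (hZ.active x hx) hle
  exact hZ.second_ne_inv hσ hs hx (heq ▸ hsx) heq

lemma IsRotation.top_eliminate_of_mem (hσ : I.IsSemistable σ) (hs : ∀ x, I.IsSecond σ x (s x))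
    (hZ : I.IsRotation σ s Z) (hx : x ∈ Z) : I.top hZ.eliminate x = I.rank x (s x) := by
  rw [top, hZ.eliminate_of_mem hx, if_neg (hZ.second_ne_self hσ hs hx)]

lemma IsRotation.top_eliminate_of_notMem (hZ : I.IsRotation σ s Z) (hx : x ∉ Z) :
    I.top hZ.eliminate x = I.top σ x := by
  rw [top, top, hZ.eliminate_of_notMem hx]

lemma IsRotation.bot_eliminate_second (hZ : I.IsRotation σ s Z) (hx : x ∈ Z) :
    I.bot hZ.eliminate (s x) = I.rank (s x) x := by
  rw [← hZ.eliminate_of_mem hx, bot_apply]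

lemma IsRotation.bot_eliminate_of_notMem (hZ : I.IsRotation σ s Z) (hx : hZ.eliminate⁻¹ x ∉ Z) :
    I.bot hZ.eliminate x = I.bot σ x := by
  have h := hZ.eliminate_of_notMem hx
  rw [perm_apply_inv_self, ← Equiv.Perm.inv_eq_iff_eq] at h
  rw [bot, bot, h]

lemma IsRotation.exists_second_eq (hZ : I.IsRotation σ s Z) (hx : hZ.eliminate⁻¹ x ∈ Z) :
    ∃ y ∈ Z, s y = x :=
  ⟨_, hx, by rw [← hZ.eliminate_of_mem hx, perm_apply_inv_self]⟩

lemma IsRotation.top_lt_top_eliminate (hσ : I.IsSemistable σ) (hs : ∀ x, I.IsSecond σ x (s x))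
    (hZ : I.IsRotation σ s Z) (hx : x ∈ Z) : I.top σ x < I.top hZ.eliminate x := by
  rw [hZ.top_eliminate_of_mem hσ hs hx]
  exact (hZ.isCand hσ hs hx).top_lt

lemma IsRotation.sum_top_lt (hσ : I.IsSemistable σ) (hs : ∀ x, I.IsSecond σ x (s x))
    (hZ : I.IsRotation σ s Z) (hne : Z.Nonempty) :
    ∑ x, I.top σ x < ∑ x, I.top hZ.eliminate x := by
  obtain ⟨x, hx⟩ := hne
  refine Finset.sum_lt_sum (fun y _ => ?_)
    ⟨x, Finset.mem_univ x, hZ.top_lt_top_eliminate hσ hs hx⟩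
  by_cases hy : y ∈ Z
  · exact (hZ.top_lt_top_eliminate hσ hs hy).le
  · exact (hZ.top_eliminate_of_notMem hy).ge

lemma IsRotation.bot_eliminate_le (hσ : I.IsSemistable σ) (hs : ∀ x, I.IsSecond σ x (s x))
    (hZ : I.IsRotation σ s Z) (x : Fin n) : I.bot hZ.eliminate x ≤ I.bot σ x := by
  by_cases hx : hZ.eliminate⁻¹ x ∈ Z
  · obtain ⟨y, hy, rfl⟩ := hZ.exists_second_eq hx
    rw [hZ.bot_eliminate_second hy]
    exact (hZ.isCand hσ hs hy).lt_bot.le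
  · exact (hZ.bot_eliminate_of_notMem hx).le

lemma IsRotation.top_eliminate_le_bot (hσ : I.IsSemistable σ) (hs : ∀ x, I.IsSecond σ x (s x))
    (hZ : I.IsRotation σ s Z) (x : Fin n) : I.top hZ.eliminate x ≤ I.bot hZ.eliminate x := by
  by_cases hpred : hZ.eliminate⁻¹ x ∈ Z
  · obtain ⟨y, hy, rfl⟩ := hZ.exists_second_eq hpred
    rw [hZ.bot_eliminate_second hy]
    by_cases hx : s y ∈ Z
    · rw [hZ.top_eliminate_of_mem hσ hs hx]
      exact hZ.rank_second_second_le hσ hs hy hx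
    · rw [hZ.top_eliminate_of_notMem hx]
      exact (hs y).top_le_rank hσ (hZ.active y hy) (hZ.second_ne_self hσ hs hy)
  · rw [hZ.bot_eliminate_of_notMem hpred]
    by_cases hx : x ∈ Z
    · rw [hZ.top_eliminate_of_mem hσ hs hx]
      exact (hs x).rank_le_bot hσ (hZ.active x hx)
    · rw [hZ.top_eliminate_of_notMem hx]
      exact hσ.top_le x

lemma IsRotation.isSemistable_eliminate (hσ : I.IsSemistable σ)
    (hs : ∀ x, I.IsSecond σ x (s x)) (hZ : I.IsRotation σ s Z) :
    I.IsSemistable hZ.eliminate where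
  edge i hi := by
    by_cases h : i ∈ Z
    · rw [hZ.eliminate_of_mem h]
      exact (hZ.isCand hσ hs h).edge
    · rw [hZ.eliminate_of_notMem h] at hi ⊢
      exact hσ.edge i hi
  top_le := hZ.top_eliminate_le_bot hσ hs
  blocked i j he hlt := by
    refine (hZ.bot_eliminate_le hσ hs j).trans ?_
    by_cases hi : i ∈ Z
    · rw [hZ.top_eliminate_of_mem hσ hs hi] at hlt
      exact (hs i).bot_le_rank hσ he hlt
    · rw [hZ.top_eliminate_of_notMem hi] at hlt
      exact hσ.blocked i j he hlt

lemma IsSemistable.isRotation_range_iterate (hσ : I.IsSemistable σ)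
    (hs : ∀ x, I.IsSecond σ x (s x)) (hx : I.rank x (s x) < I.bot σ x) :
    I.IsRotation σ s (Set.range fun k => (displaced σ s)^[k] ((displaced σ s)^[n] x)) := by
  have hactive : ∀ k, I.top σ ((displaced σ s)^[k] x) < I.bot σ ((displaced σ s)^[k] x) := by
    intro k
    induction k with
    | zero => exact ((hs x).isCand_of_lt_bot hx).top_lt.trans hx
    | succ k ih =>
      rw [Function.iterate_succ_apply']
      exact hσ.top_lt_bot_displaced hs ih
  have hunsettled : ∀ k, ¬ IsSettled σ s ((displaced σ s)^[k] x) := by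
    intro k
    induction k with
    | zero => exact fun h => hx.ne (congrArg (I.rank x) (h 0))
    | succ k ih =>
      rw [Function.iterate_succ_apply']
      exact fun h => ih (.of_displaced hσ hs (hactive k) h)
  have hperiodic := iterate_card_mem_periodicPts (displaced σ s) x
  rw [Fintype.card_fin] at hperiodic
  refine ⟨?_, ?_, bijOn_range_iterate hperiodic⟩ <;> rintro _ ⟨k, rfl⟩ <;>
    simp only [← Function.iterate_add_apply]
  · exact hactive _
  · exact hunsettled _

end Rotation

theorem exists_isStablePartition (I : Roommates n) :
    ∃ σ : Equiv.Perm (Fin n), I.IsStablePartition σ := by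
  have : Nonempty {σ // I.IsSemistable σ} := ⟨⟨1, I.isSemistable_one⟩⟩
  obtain ⟨⟨σ, hσ⟩, hmax⟩ :=
    Finite.exists_max fun σ : {σ // I.IsSemistable σ} => ∑ x, I.top σ x
  choose s hs using I.exists_isSecond σ
  refine ⟨σ, hσ.isStablePartition hs fun x => ?_⟩
  by_contra! hx
  have hZ := hσ.isRotation_range_iterate hs hx
  exact (hmax ⟨_, hZ.isSemistable_eliminate hσ hs⟩).not_gt
    (hZ.sum_top_lt hσ hs (Set.range_nonempty _))

end Roommates

namespace Roommates

section Cut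

variable {α : Type*} {π : Equiv.Perm α} {b : α → α} {k : α → ℕ} {x y : α}

/-- `b` picks a vertex of every cycle of `π`, and `k x` is the distance from `b x` to `x`. -/
structure IsCut (π : Equiv.Perm α) (b : α → α) (k : α → ℕ) : Prop where
  base : ∀ x, b (π x) = b x
  pow : ∀ x, (π ^ k x) (b x) = x
  min : ∀ x, ∀ m < k x, (π ^ m) (b x) ≠ x

/-- The pairing that arises when every cycle of `π` is cut just before its vertex `b x` and the
resulting path is paired up from its beginning. Here `k x` is the position of `x` on the path. -/
def pairUp [DecidableEq α] (π : Equiv.Perm α) (b : α → α) (k : α → ℕ) (x : α) : α :=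
  if Odd (k x) then π⁻¹ x else if π x = b x then x else π x

lemma exists_isCut [Finite α] (hb : ∀ x, b (π x) = b x) (hs : ∀ x, π.SameCycle (b x) x) :
    ∃ k, IsCut π b k := by
  classical
  have hpow : ∀ x, ∃ m : ℕ, (π ^ m) (b x) = x := fun x => (hs x).exists_nat_pow_eq
  exact ⟨fun x => Nat.find (hpow x), hb, fun x => Nat.find_spec (hpow x),
    fun x m => Nat.find_min (hpow x)⟩

lemma IsCut.apply_of_ne (h : IsCut π b k) (hx : π x ≠ b x) : k (π x) = k x + 1 := by
  have hsucc : (π ^ (k x + 1)) (b (π x)) = π x := by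
    rw [h.base, pow_succ', Equiv.Perm.mul_apply, h.pow]
  have hle : k (π x) ≤ k x + 1 := not_lt.1 fun hlt => h.min (π x) _ hlt hsucc
  have hpow := h.pow (π x)
  rw [h.base] at hpow
  rcases hk : k (π x) with _ | m
  · rw [hk] at hpow
    exact absurd hpow.symm hx
  · rw [hk, pow_succ', Equiv.Perm.mul_apply] at hpow
    have hm : k x ≤ m := not_lt.1 fun hlt => h.min x m hlt (π.injective hpow)
    omega

lemma IsCut.eq_zero (h : IsCut π b k) (hx : x = b x) : k x = 0 := by
  by_contra hk
  exact h.min x 0 (Nat.pos_of_ne_zero hk) hx.symm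

lemma IsCut.base_eq [Finite α] (h : IsCut π b k) (hxy : π.SameCycle x y) : b x = b y := by
  obtain ⟨m, rfl⟩ := hxy.exists_nat_pow_eq
  clear hxy
  induction m with
  | zero => rfl
  | succ m ih => rw [pow_succ', Equiv.Perm.mul_apply, h.base, ih]

lemma IsCut.sameCycle (h : IsCut π b k) (x : α) : π.SameCycle (b x) x :=
  ⟨k x, by rw [zpow_natCast, h.pow]⟩

section DecidableEq

variable [DecidableEq α]

lemma IsCut.pairUp_invol (h : IsCut π b k) (x : α) : pairUp π b k (pairUp π b k x) = x := by
  by_cases ho : Odd (k x)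
  · have hne : π (π⁻¹ x) ≠ b (π⁻¹ x) := by
      rw [← h.base, perm_apply_inv_self]
      intro hx
      rw [h.eq_zero hx] at ho
      exact Nat.not_odd_zero ho
    have hk := h.apply_of_ne hne
    rw [perm_apply_inv_self] at hk
    have hinv : ¬ Odd (k (π⁻¹ x)) := by
      rwa [hk, Nat.odd_add_one] at ho
    rw [show pairUp π b k x = π⁻¹ x from if_pos ho, pairUp, if_neg hinv, if_neg hne,
      perm_apply_inv_self]
  · by_cases hx : π x = b x
    · have hself : pairUp π b k x = x := by rw [pairUp, if_neg ho, if_pos hx]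
      rw [hself, hself]
    · have hodd : Odd (k (π x)) := by
        rw [h.apply_of_ne hx, Nat.odd_add_one]
        exact ho
      rw [show pairUp π b k x = π x by rw [pairUp, if_neg ho, if_neg hx], pairUp, if_pos hodd,
        perm_inv_apply_self]

lemma pairUp_eq_or (π : Equiv.Perm α) (b : α → α) (k : α → ℕ) (h : pairUp π b k x ≠ x) :
    pairUp π b k x = π x ∨ pairUp π b k x = π⁻¹ x := by
  unfold pairUp at h ⊢
  split_ifs at h ⊢
  · exact .inr rfl
  · exact absurd rfl h
  · exact .inl rfl

lemma pairUp_eq_self_iff (hx : π x ≠ x) : pairUp π b k x = x ↔ ¬ Odd (k x) ∧ π x = b x := by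
  unfold pairUp
  split_ifs with hodd hb
  · simp only [hodd, not_true, false_and, iff_false]
    exact inv_apply_ne hx
  · simp only [hodd, hb, not_false_eq_true, and_self]
  · simp only [hb, hx, and_false]

end DecidableEq

end Cut

section OddCycles

variable {α : Type*} [Fintype α] [DecidableEq α] {π : Equiv.Perm α} {x y : α}

/-- `x` lies on a cycle of `π` of odd length at least three: the support of `π.cycleOf x` is empty
if `x` is a fixed point. -/
def OnOddCycle (π : Equiv.Perm α) (x : α) : Prop := Odd (π.cycleOf x).support.card

lemma OnOddCycle.apply_ne (h : OnOddCycle π x) : π x ≠ x := fun hx => by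
  rw [OnOddCycle, (Equiv.Perm.cycleOf_eq_one_iff π).2 hx, Equiv.Perm.support_one] at h
  exact Nat.not_odd_zero h

lemma onOddCycle_congr (h : π.SameCycle x y) : OnOddCycle π x ↔ OnOddCycle π y := by
  rw [OnOddCycle, OnOddCycle, h.cycleOf_eq]

lemma OnOddCycle.mem_support_cycleOf_iff (h : OnOddCycle π x) :
    y ∈ (π.cycleOf x).support ↔ π.SameCycle x y := by
  rw [Equiv.Perm.mem_support_cycleOf_iff, Equiv.Perm.mem_support]
  exact and_iff_left h.apply_ne

lemma IsCut.card_support_cycleOf {b : α → α} {k : α → ℕ} (h : IsCut π b k) (hx : π x ≠ x)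
    (hb : π x = b x) : (π.cycleOf x).support.card = k x + 1 := by
  have hcycle := π.isCycle_cycleOf hx
  have hpow : ∀ m : ℕ, ((π.cycleOf x) ^ m) x = (π ^ m) x := π.cycleOf_pow_apply_self x
  rw [← hcycle.orderOf]
  apply le_antisymm
  · apply Nat.le_of_dvd (Nat.succ_pos _)
    rw [orderOf_dvd_iff_pow_eq_one, hcycle.pow_eq_one_iff' (x := x) (by simpa using hx), hpow,
      pow_succ, Equiv.Perm.mul_apply, hb, h.pow]
  · by_contra! hlt
    set L := orderOf (π.cycleOf x)
    have hL : 0 < L := orderOf_pos _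
    have hperiod : (π ^ L) x = x := by rw [← hpow, pow_orderOf_eq_one, Equiv.Perm.one_apply]
    refine h.min x (k x - L) (by omega) ((π ^ L).injective ?_)
    rw [hperiod, ← Equiv.Perm.mul_apply, ← pow_add, Nat.add_sub_cancel' (by omega), h.pow]

lemma IsCut.pairUp_eq_self_iff {b : α → α} {k : α → ℕ} (h : IsCut π b k) (hx : π x ≠ x) :
    pairUp π b k x = x ↔ OnOddCycle π x ∧ π x = b x := by
  rw [Roommates.pairUp_eq_self_iff hx]
  refine and_congr_left fun hb => ?_
  rw [OnOddCycle, h.card_support_cycleOf hx hb, Nat.odd_add_one]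

end OddCycles

section Picks

variable {n : ℕ} {π τ : Equiv.Perm (Fin n)} {D : Finset (Fin n)} {x : Fin n}

lemma cycleOf_mem_oddCycles_iff : π.cycleOf x ∈ oddCycles π ↔ OnOddCycle π x := by
  rw [oddCycles, Finset.mem_filter, Equiv.Perm.cycleOf_mem_cycleFactorsFinset_iff,
    Equiv.Perm.mem_support]
  exact and_iff_right_of_imp OnOddCycle.apply_ne

lemma eq_cycleOf_of_mem_oddCycles (hτ : τ ∈ oddCycles π) (hx : x ∈ τ.support) :
    τ = π.cycleOf x :=
  Equiv.Perm.cycle_is_cycleOf hx (Finset.mem_filter.1 hτ).1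

lemma isCycle_of_mem_oddCycles (hτ : τ ∈ oddCycles π) : τ.IsCycle :=
  (Equiv.Perm.mem_cycleFactorsFinset_iff.1 (Finset.mem_filter.1 hτ).1).1

lemma picksOnePerOddCycle_iff :
    PicksOnePerOddCycle π D ↔ (∀ i ∈ D, OnOddCycle π i) ∧
      ∀ x, OnOddCycle π x → ∃! i, i ∈ D ∧ π.SameCycle x i := by
  constructor
  · rintro ⟨hmem, hunique⟩
    refine ⟨fun i hi => ?_, fun x hx => ?_⟩
    · obtain ⟨τ, hτ, hiτ⟩ := hmem i hi
      rwa [← cycleOf_mem_oddCycles_iff, ← eq_cycleOf_of_mem_oddCycles hτ hiτ]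
    · simpa only [hx.mem_support_cycleOf_iff] using hunique _ (cycleOf_mem_oddCycles_iff.2 hx)
  · rintro ⟨hmem, hunique⟩
    refine ⟨fun i hi => ⟨_, cycleOf_mem_oddCycles_iff.2 (hmem i hi), ?_⟩, fun τ hτ => ?_⟩
    · exact (hmem i hi).mem_support_cycleOf_iff.2 (.refl π i)
    · obtain ⟨x, hxτ⟩ := (isCycle_of_mem_oddCycles hτ).nonempty_support
      obtain rfl := eq_cycleOf_of_mem_oddCycles hτ hxτ
      have hx := cycleOf_mem_oddCycles_iff.1 hτ
      simpa only [hx.mem_support_cycleOf_iff] using hunique x hx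

lemma PicksOnePerOddCycle.eq_of_sameCycle (hD : PicksOnePerOddCycle π D) {d e : Fin n}
    (hd : d ∈ D) (he : e ∈ D) (h : π.SameCycle d e) : d = e := by
  obtain ⟨hmem, hunique⟩ := picksOnePerOddCycle_iff.1 hD
  exact (hunique d (hmem d hd)).unique ⟨hd, .refl π d⟩ ⟨he, h⟩

lemma PicksOnePerOddCycle.card_le (hD : PicksOnePerOddCycle π D) :
    D.card ≤ (oddCycles π).card := by
  have hmem := (picksOnePerOddCycle_iff.1 hD).1
  refine Finset.card_le_card_of_injOn π.cycleOf
    (fun d hd => cycleOf_mem_oddCycles_iff.2 (hmem d hd)) fun d hd e he hde => ?_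
  refine hD.eq_of_sameCycle hd he ((hmem d hd).mem_support_cycleOf_iff.1 ?_)
  rw [hde]
  exact (hmem e he).mem_support_cycleOf_iff.2 (.refl π e)

lemma three_mul_card_oddCycles_le (π : Equiv.Perm (Fin n)) : 3 * (oddCycles π).card ≤ n :=
  calc 3 * (oddCycles π).card = ∑ _τ ∈ oddCycles π, 3 := by
        rw [Finset.sum_const, smul_eq_mul, mul_comm]
    _ ≤ ∑ τ ∈ oddCycles π, τ.support.card := by
        refine Finset.sum_le_sum fun τ hτ => ?_
        have htwo := (isCycle_of_mem_oddCycles hτ).two_le_card_support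
        obtain ⟨m, hm⟩ := (Finset.mem_filter.1 hτ).2
        omega
    _ ≤ ∑ τ ∈ π.cycleFactorsFinset, τ.support.card :=
        Finset.sum_le_sum_of_subset (Finset.filter_subset _ _)
    _ = π.support.card := by rw [← π.sum_cycleType, Equiv.Perm.cycleType_def]; rfl
    _ ≤ n := by simpa using Finset.card_le_univ π.support

/-- The least element of the cycle of `x`. -/
def leastInCycle (π : Equiv.Perm (Fin n)) (x : Fin n) : Fin n :=
  (Finset.univ.filter (π.SameCycle x)).min' ⟨x, by simp [Equiv.Perm.SameCycle.refl]⟩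

lemma sameCycle_leastInCycle (π : Equiv.Perm (Fin n)) (x : Fin n) :
    π.SameCycle x (leastInCycle π x) :=
  (Finset.mem_filter.1 (Finset.min'_mem (Finset.univ.filter (π.SameCycle x)) _)).2

lemma leastInCycle_le {π : Equiv.Perm (Fin n)} {x y : Fin n} (h : π.SameCycle x y) :
    leastInCycle π x ≤ y :=
  Finset.min'_le _ _ (Finset.mem_filter.2 ⟨Finset.mem_univ y, h⟩)

lemma leastInCycle_apply (π : Equiv.Perm (Fin n)) (x : Fin n) :
    leastInCycle π (π x) = leastInCycle π x := by
  simp only [leastInCycle, Equiv.Perm.sameCycle_apply_left]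

lemma exists_isCut_leastInCycle (π : Equiv.Perm (Fin n)) : ∃ k, IsCut π (leastInCycle π) k :=
  exists_isCut (leastInCycle_apply π) fun x => (sameCycle_leastInCycle π x).symm

open Classical in
lemma PicksOnePerOddCycle.exists_isCut (hD : PicksOnePerOddCycle π D) :
    ∃ b k, IsCut π b k ∧ ∀ d ∈ D, π d = b d := by
  let b : Fin n → Fin n := fun x =>
    if h : ∃ d ∈ D, π.SameCycle x d then π h.choose else leastInCycle π x
  have hbase : ∀ x, b (π x) = b x := fun x => by
    simp only [b, Equiv.Perm.sameCycle_apply_left, leastInCycle_apply]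
  have hsame : ∀ x, π.SameCycle (b x) x := fun x => by
    by_cases h : ∃ d ∈ D, π.SameCycle x d
    · simp only [b, dif_pos h, Equiv.Perm.sameCycle_apply_left]
      exact h.choose_spec.2.symm
    · simp only [b, dif_neg h]
      exact (sameCycle_leastInCycle π x).symm
  obtain ⟨k, hk⟩ := Roommates.exists_isCut hbase hsame
  refine ⟨b, k, hk, fun d hd => ?_⟩
  have h : ∃ e ∈ D, π.SameCycle d e := ⟨d, hd, .refl π d⟩
  simp only [b, dif_pos h]
  exact congrArg π (hD.eq_of_sameCycle hd h.choose_spec.1 h.choose_spec.2)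

open Classical in
lemma IsCut.exists_picks {b : Fin n → Fin n} {k : Fin n → ℕ} (h : IsCut π b k) :
    ∃ D : Finset (Fin n), PicksOnePerOddCycle π D ∧ ∀ d ∈ D, π d = b d := by
  refine ⟨Finset.univ.filter fun x => OnOddCycle π x ∧ π x = b x,
    picksOnePerOddCycle_iff.2 ⟨fun i hi => (Finset.mem_filter.1 hi).2.1, fun x hx => ?_⟩,
    fun d hd => (Finset.mem_filter.1 hd).2.2⟩
  have hs : π.SameCycle x (π⁻¹ (b x)) := by
    rw [← Equiv.Perm.sameCycle_apply_right, perm_apply_inv_self]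
    exact (h.sameCycle x).symm
  refine ⟨π⁻¹ (b x), ⟨Finset.mem_filter.2 ⟨Finset.mem_univ _, (onOddCycle_congr hs).1 hx, ?_⟩, hs⟩,
    fun y hy => ?_⟩
  · rw [perm_apply_inv_self, ← h.base_eq hs]
  · rw [Equiv.Perm.eq_inv_iff_eq, (Finset.mem_filter.1 hy.1).2.2, h.base_eq hy.2]

theorem exists_picksOnePerOddCycle (π : Equiv.Perm (Fin n)) :
    ∃ D : Finset (Fin n), PicksOnePerOddCycle π D := by
  obtain ⟨k, hk⟩ := exists_isCut_leastInCycle π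
  obtain ⟨D, hD, -⟩ := hk.exists_picks
  exact ⟨D, hD⟩

end Picks

section Matching

variable {n : ℕ} {I : Roommates n} {π : Equiv.Perm (Fin n)} {D : Finset (Fin n)}

/-- The matching that consists of the pairs given by `pairUp`. -/
def IsCut.matching {b : Fin n → Fin n} {k : Fin n → ℕ} (h : IsCut π b k)
    (hπ : ∀ i, π i ≠ i → I.Edge i (π i)) : I.Matching where
  partner := pairUp π b k
  invol := h.pairUp_invol
  edge x hx := by
    have hne : π x ≠ x := fun hfix => by
      rcases pairUp_eq_or π b k hx with hp | hp
      · exact hx (hp.trans hfix)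
      · exact hx (hp.trans (Equiv.Perm.inv_eq_iff_eq.2 hfix.symm))
    rcases pairUp_eq_or π b k hx with hp | hp <;> rw [hp]
    · exact hπ x hne
    · exact edge_inv hπ hne

lemma IsCut.isObtainedFrom {b : Fin n → Fin n} {k : Fin n → ℕ} (h : IsCut π b k)
    (hπ : ∀ i, π i ≠ i → I.Edge i (π i)) (hD : PicksOnePerOddCycle π D)
    (hb : ∀ d ∈ D, π d = b d) : I.IsObtainedFrom π D (h.matching hπ) where
  along _ := pairUp_eq_or π b k
  deleted d hd := by
    have hodd := (picksOnePerOddCycle_iff.1 hD).1 d hd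
    exact (h.pairUp_eq_self_iff hodd.apply_ne).2 ⟨hodd, hb d hd⟩
  perfect x hxD hx hself := by
    obtain ⟨hodd, hxb⟩ := (h.pairUp_eq_self_iff hx).1 hself
    obtain ⟨d, ⟨hd, hxd⟩, -⟩ := (picksOnePerOddCycle_iff.1 hD).2 x hodd
    have hdx : π d = π x := by rw [hb d hd, hxb, h.base_eq hxd]
    exact hxD (π.injective hdx ▸ hd)

theorem PicksOnePerOddCycle.exists_isObtainedFrom (hD : PicksOnePerOddCycle π D)
    (hπ : ∀ i, π i ≠ i → I.Edge i (π i)) : ∃ M : I.Matching, I.IsObtainedFrom π D M := by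
  obtain ⟨b, k, hk, hb⟩ := hD.exists_isCut
  exact ⟨_, hk.isObtainedFrom hπ hD hb⟩

end Matching

section Improving

variable {n : ℕ} {I : Roommates n} {π : Equiv.Perm (Fin n)} {D : Finset (Fin n)}
  {M : I.Matching}

lemma IsStablePartition.not_prefers_inv (hπ : I.IsStablePartition π) {i j : Fin n}
    (he : I.Edge i j) (hi : I.Prefers i j (π⁻¹ i)) : ¬ I.Prefers j i (π⁻¹ j) := by
  intro hj
  rcases hπ.stable i j he (.inr hi) with h | h
  · exact lt_irrefl _ (h ▸ hj)
  · exact lt_asymm hj h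

lemma IsObtainedFrom.rank_partner_le (hπ : I.IsStablePartition π)
    (hM : I.IsObtainedFrom π D M) {i : Fin n} (hi : i ∉ D) :
    I.rank i (M.partner i) ≤ I.rank i (π⁻¹ i) := by
  by_cases hf : π i = i
  · exact (I.rank_le _ _).trans_eq (bot_of_fixed hf).symm
  · rcases hM.along i (hM.perfect i hi hf) with h | h
    · rw [h]
      by_cases heq : π i = π⁻¹ i
      · rw [heq]
      · exact (I.prefers_iff.1 (hπ.prefers i heq)).le
    · rw [h]

lemma Matching.partner_ne_of_prefers (M : I.Matching) {i j : Fin n}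
    (h : I.Prefers i (M.partner i) j) : M.partner i ≠ i := fun hfix => by
  rw [hfix, prefers_iff, rank_self] at h
  exact h.not_ge (I.rank_le i j)

lemma IsStablePartition.two_mul_card_le (hπ : I.IsStablePartition π) (M : I.Matching)
    {S : Finset (Fin n)} (hS : ∀ i ∈ S, I.Prefers i (M.partner i) (π⁻¹ i)) :
    2 * S.card ≤ n := by
  classical
  have hdisj : Disjoint S (S.image M.partner) := by
    rw [Finset.disjoint_left]
    intro j hj hj'
    obtain ⟨i, hi, rfl⟩ := Finset.mem_image.1 hj'
    have hback := hS _ hj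
    rw [M.invol] at hback
    exact hπ.not_prefers_inv (M.edge i (M.partner_ne_of_prefers (hS i hi))) (hS i hi) hback
  have hinj : Function.Injective M.partner := Function.LeftInverse.injective M.invol
  calc 2 * S.card = (S ∪ S.image M.partner).card := by
        rw [Finset.card_union_of_disjoint hdisj, Finset.card_image_of_injective _ hinj, two_mul]
    _ ≤ n := by simpa using Finset.card_le_univ (S ∪ S.image M.partner)

lemma IsObtainedFrom.two_mul_card_improving_le (hπ : I.IsStablePartition π)
    (hM : I.IsObtainedFrom π D M) (M' : I.Matching) :
    2 * (I.improving M M').card ≤ n + 2 * D.card := by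
  have hprefers : ∀ i ∈ I.improving M M' \ D, I.Prefers i (M'.partner i) (π⁻¹ i) := by
    intro i hi
    rw [Finset.mem_sdiff, improving, Finset.mem_filter, prefers_iff] at hi
    exact I.prefers_iff.2 (hi.1.2.trans_le (hM.rank_partner_le hπ hi.2))
  have hhalf := hπ.two_mul_card_le M' hprefers
  have hsdiff : (I.improving M M').card ≤ (I.improving M M' \ D).card + D.card :=
    Finset.card_le_card_sdiff_add_card
  omega

theorem half_add_card_oddCycles_le (π : Equiv.Perm (Fin n)) :
    (n : ℝ) / 2 + ((oddCycles π).card : ℝ) ≤ 5 * (n : ℝ) / 6 := by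
  have h : (3 : ℝ) * (oddCycles π).card ≤ n := by exact_mod_cast three_mul_card_oddCycles_le π
  linarith

theorem IsObtainedFrom.card_improving_le (hπ : I.IsStablePartition π)
    (hD : PicksOnePerOddCycle π D) (hM : I.IsObtainedFrom π D M) (M' : I.Matching) :
    ((I.improving M M').card : ℝ) ≤ (n : ℝ) / 2 + ((oddCycles π).card : ℝ) := by
  have himproving : (2 : ℝ) * (I.improving M M').card ≤ n + 2 * D.card := by
    exact_mod_cast hM.two_mul_card_improving_le hπ M'
  have hcard : (D.card : ℝ) ≤ (oddCycles π).card := by exact_mod_cast hD.card_le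
  linarith

theorem IsObtainedFrom.isKStable (hπ : I.IsStablePartition π)
    (hD : PicksOnePerOddCycle π D) (hM : I.IsObtainedFrom π D M) {c : ℝ} (hc : 5 / 6 < c) :
    I.IsKStable (c * n) M := by
  rintro ⟨M', hne, hle⟩
  have hcard := hM.card_improving_le hπ hD M'
  have hbound := half_add_card_oddCycles_le π
  rcases n.eq_zero_or_pos with rfl | hn
  · exact hne (Matching.ext (funext fun i => i.elim0))
  · have hn : (0 : ℝ) < n := by exact_mod_cast hn
    nlinarith

end Improving

end Roommates

namespace RAM

/-- Programs whose only loops are counting loops: `forLt x C` runs `C` for `x = 0, …, n - 1`,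
where `n` is the content of variable `0`. All of them halt, and their running time can be
bounded by recursion on the program. -/
inductive Code where
  | skip
  | assign (x : ℕ) (e : Expr)
  | write (a : ℕ) (e f : Expr)
  | seq (C D : Code)
  | ite (e : Expr) (C D : Code)
  | forLt (x : ℕ) (C : Code)

namespace Code

def compile : Code → Prog
  | skip => .skip
  | assign x e => .assign x e
  | write a e f => .write a e f
  | seq C D => .seq C.compile D.compile
  | ite e C D => .ite e C.compile D.compile
  | forLt x C => .seq (.assign x (.const 0)) (.loop (.sub (.var 0) (.var x))
      (.seq C.compile (.assign x (.add (.var x) (.const 1)))))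

/-- One pass through a loop with counter `x` whose body acts as `f`. -/
def loopStep (x : ℕ) (f : State → State) (s : State) : State :=
  (f s).setVar x (s.var x + 1)

/-- The state in which a program halts, see `exec_compile`. -/
def run : Code → State → State
  | skip, s => s
  | assign x e, s => s.setVar x (e.eval s)
  | write a e f, s => s.setArr a (e.eval s) (f.eval s)
  | seq C D, s => D.run (C.run s)
  | ite e C D, s => if e.eval s ≠ 0 then C.run s else D.run s
  | forLt x C, s => (loopStep x C.run)^[s.var 0] (s.setVar x 0)

/-- A bound for the running time, as a polynomial in the content of variable `0`. -/
noncomputable def time : Code → Polynomial ℕ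
  | skip => 1
  | assign _ e => .C (e.cost + 1)
  | write _ e f => .C (e.cost + f.cost + 1)
  | seq C D => C.time + D.time
  | ite e C D => .C (e.cost + 1) + C.time + D.time
  | forLt _ C => .X * (C.time + .C 8) + .C 6

/-- Whether a program contains an assignment to a variable. -/
def setsVar : Code → ℕ → Bool
  | skip, _ => false
  | assign x _, y => x == y
  | write _ _ _, _ => false
  | seq C D, y => C.setsVar y || D.setsVar y
  | ite _ C D, y => C.setsVar y || D.setsVar y
  | forLt x C, y => x == y || C.setsVar y

/-- Whether a program contains a write access to an array. -/
def setsArr : Code → ℕ → Bool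
  | skip, _ => false
  | assign _ _, _ => false
  | write a _ _, b => a == b
  | seq C D, b => C.setsArr b || D.setsArr b
  | ite _ C D, b => C.setsArr b || D.setsArr b
  | forLt _ C, b => C.setsArr b

/-- Variable `0` is not assigned to, and no loop body assigns to the counter of the loop. -/
def WF : Code → Bool
  | skip => true
  | assign x _ => x != 0
  | write _ _ _ => true
  | seq C D => C.WF && D.WF
  | ite _ C D => C.WF && D.WF
  | forLt x C => C.WF && !C.setsVar x && x != 0

/-- The state `u` differs from `s` at most in what the program `C` may change. -/
structure Frame (C : Code) (s u : State) : Prop where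
  var : ∀ y, C.setsVar y = false → u.var y = s.var y
  arr : ∀ a, C.setsArr a = false → u.arr a = s.arr a

end Code

section State

variable (s : State) (x v y a k b j : ℕ)

lemma setVar_var : (s.setVar x v).var y = if y = x then v else s.var y := by
  simp only [State.setVar, Function.update_apply]

lemma setVar_arr : (s.setVar x v).arr = s.arr := rfl

lemma setArr_var : (s.setArr a k v).var = s.var := rfl

lemma setArr_arr : (s.setArr a k v).arr b j = if b = a ∧ j = k then v else s.arr b j := by
  by_cases h : b = a
  · subst h; simp [State.setArr, Function.update_apply]
  · simp [State.setArr, h]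

end State

namespace Code

variable {C D : Code} {s u v : State} {x : ℕ}

lemma Frame.refl (C : Code) (s : State) : C.Frame s s :=
  ⟨fun _ _ => rfl, fun _ _ => rfl⟩

lemma Frame.trans (h : C.Frame s u) (h' : C.Frame u v) : C.Frame s v :=
  ⟨fun y hy => (h'.var y hy).trans (h.var y hy), fun a ha => (h'.arr a ha).trans (h.arr a ha)⟩

lemma Frame.mono (h : C.Frame s u) (hv : ∀ y, D.setsVar y = false → C.setsVar y = false)
    (ha : ∀ a, D.setsArr a = false → C.setsArr a = false) : D.Frame s u :=
  ⟨fun y hy => h.var y (hv y hy), fun a h' => h.arr a (ha a h')⟩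

lemma frame_setVar (h : C.setsVar x = true) (s : State) (k : ℕ) : C.Frame s (s.setVar x k) := by
  refine ⟨fun y hy => ?_, fun _ _ => rfl⟩
  rw [setVar_var, if_neg]
  rintro rfl
  simp [h] at hy

lemma frame_setArr {a : ℕ} (h : C.setsArr a = true) (s : State) (j k : ℕ) :
    C.Frame s (s.setArr a j k) := by
  refine ⟨fun _ _ => rfl, fun b hb => ?_⟩
  have hba : b ≠ a := by
    rintro rfl
    simp [h] at hb
  ext i
  simp [setArr_arr, hba]

lemma Frame.loopStep (h : C.Frame s (C.run s)) : (forLt x C).Frame s (loopStep x C.run s) :=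
  (h.mono (by simp [setsVar]) (by simp [setsArr])).trans
    (frame_setVar (by simp [setsVar]) _ _)

lemma Frame.iterate_loopStep (h : ∀ s, C.Frame s (C.run s)) (m : ℕ) (s : State) :
    (forLt x C).Frame s ((Code.loopStep x C.run)^[m] s) := by
  induction m with
  | zero => exact Frame.refl _ _
  | succ m ih =>
    rw [Function.iterate_succ_apply']
    exact ih.trans (h _).loopStep

lemma frame_run (C : Code) (s : State) : C.Frame s (C.run s) := by
  induction C generalizing s with
  | skip => exact Frame.refl _ _
  | assign x e => exact frame_setVar (by simp [setsVar]) _ _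
  | write a e f => exact frame_setArr (by simp [setsArr]) _ _ _
  | seq C D hC hD =>
    exact ((hC s).mono (by simp +contextual [setsVar]) (by simp +contextual [setsArr])).trans
      ((hD _).mono (by simp [setsVar]) (by simp [setsArr]))
  | ite e C D hC hD =>
    unfold run
    split_ifs
    · exact (hC s).mono (by simp +contextual [setsVar]) (by simp +contextual [setsArr])
    · exact (hD s).mono (by simp [setsVar]) (by simp [setsArr])
  | forLt x C hC =>
    exact (frame_setVar (by simp [setsVar]) _ _).trans (Frame.iterate_loopStep hC _ _)

lemma setsVar_zero (h : C.WF = true) : C.setsVar 0 = false := by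
  induction C with
  | skip => rfl
  | assign x e => simpa [WF, setsVar] using h
  | write a e f => rfl
  | seq C D hC hD =>
    simp only [WF, Bool.and_eq_true] at h
    simp [setsVar, hC h.1, hD h.2]
  | ite e C D hC hD =>
    simp only [WF, Bool.and_eq_true] at h
    simp [setsVar, hC h.1, hD h.2]
  | forLt x C hC =>
    simp only [WF, Bool.and_eq_true, bne_iff_ne] at h
    simp [setsVar, hC h.1.1, h.2]

lemma wf_forLt (h : (forLt x C).WF = true) : C.WF = true ∧ C.setsVar x = false ∧ x ≠ 0 := by
  simpa [WF, and_assoc] using h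

lemma run_forLt {n : ℕ} (hn : s.var 0 = n) (Inv : ℕ → State → Prop) (init : Inv 0 (s.setVar x 0))
    (step : ∀ (k : Fin n) (u : State), (forLt x C).Frame s u → u.var x = k → Inv k u →
      Inv (k + 1) ((C.run u).setVar x (k + 1))) :
    Inv n ((forLt x C).run s) := by
  have key : ∀ m ≤ n, (forLt x C).Frame s ((loopStep x C.run)^[m] (s.setVar x 0)) ∧
      ((loopStep x C.run)^[m] (s.setVar x 0)).var x = m ∧
      Inv m ((loopStep x C.run)^[m] (s.setVar x 0)) := by
    intro m
    induction m with
    | zero =>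
      exact fun _ => ⟨frame_setVar (by simp [setsVar]) _ _, by simp [setVar_var], init⟩
    | succ m ih =>
      intro hm
      obtain ⟨hframe, hcount, hinv⟩ := ih (by omega)
      have hnext := step ⟨m, hm⟩ _ hframe hcount hinv
      rw [Function.iterate_succ_apply']
      refine ⟨hframe.trans (frame_run C _).loopStep, ?_, ?_⟩
      · rw [loopStep, setVar_var, if_pos rfl, hcount]
      · rwa [loopStep, hcount]
  rw [run, hn]
  exact (key n le_rfl).2.2

lemma forall_lt_succ_iff {n : ℕ} {P : Fin n → Prop} (k : Fin n) :
    (∀ j : Fin n, (j : ℕ) < k + 1 → P j) ↔ P k ∧ ∀ j : Fin n, (j : ℕ) < k → P j := by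
  refine ⟨fun h => ⟨h k k.1.lt_succ_self, fun j hj => h j (hj.trans k.1.lt_succ_self)⟩,
    fun ⟨hk, h⟩ j hj => ?_⟩
  rcases (Fin.le_def.2 (Nat.lt_succ_iff.1 hj)).lt_or_eq with hlt | rfl
  · exact h j hlt
  · exact hk

lemma run_forLt_forall {n : ℕ} (hn : s.var 0 = n) (Q : Fin n → (ℕ → ℕ → ℕ) → Prop)
    (set : ∀ (k : Fin n) (u : State), (forLt x C).Frame s u → u.var x = k → Q k (C.run u).arr)
    (keep : ∀ (k : Fin n) (u : State), (forLt x C).Frame s u → u.var x = k →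
      ∀ j < k, Q j u.arr → Q j (C.run u).arr) (k : Fin n) :
    Q k ((forLt x C).run s).arr := by
  refine run_forLt hn (fun m u => ∀ j : Fin n, (j : ℕ) < m → Q j u.arr)
    (fun j hj => absurd hj (Nat.not_lt_zero _)) (fun k u hf hu hinv => ?_) k k.2
  exact (forall_lt_succ_iff k).2
    ⟨set k u hf hu, fun j hj => keep k u hf hu j hj (hinv j hj)⟩

lemma exec_loop (h : (forLt x C).WF = true)
    (hC : ∀ s, ∃ t, Exec C.compile s t (C.run s) ∧ t ≤ C.time.eval (s.var 0)) (m : ℕ) (s : State)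
    (hm : s.var 0 - s.var x = m) :
    ∃ t, Exec (.loop (.sub (.var 0) (.var x))
        (.seq C.compile (.assign x (.add (.var x) (.const 1))))) s t
        ((loopStep x C.run)^[m] s) ∧
      t ≤ m * (C.time.eval (s.var 0) + 8) + 4 := by
  obtain ⟨hWF, hx, hx0⟩ := wf_forLt h
  induction m generalizing s with
  | zero => exact ⟨_, Exec.loop_done hm, by simp [Expr.cost]⟩
  | succ m ih =>
    obtain ⟨t, ht, htle⟩ := hC s
    have hcount : (C.run s).var x = s.var x := (frame_run C s).var x hx
    have hn : (loopStep x C.run s).var 0 = s.var 0 := by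
      rw [loopStep, setVar_var, if_neg hx0.symm, (frame_run C s).var 0 (setsVar_zero hWF)]
    obtain ⟨t', ht', htle'⟩ := ih (loopStep x C.run s) (by
      rw [hn, loopStep, setVar_var, if_pos rfl]; omega)
    have hassign := Exec.assign (C.run s) x (.add (.var x) (.const 1))
    simp only [Expr.eval, hcount] at hassign
    refine ⟨_, Exec.loop_step (t' := t') (by simp only [Expr.eval]; omega)
      (Exec.seq ht hassign) ht', ?_⟩
    rw [hn] at htle'
    simp only [Expr.cost]
    rw [add_mul, one_mul]
    omega

theorem exec_compile (h : C.WF = true) (s : State) :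
    ∃ t, Exec C.compile s t (C.run s) ∧ t ≤ C.time.eval (s.var 0) := by
  induction C generalizing s with
  | skip => exact ⟨_, Exec.skip s, by simp [time]⟩
  | assign x e => exact ⟨_, Exec.assign s x e, by simp [time]⟩
  | write a e f => exact ⟨_, Exec.write s a e f, by simp [time]⟩
  | seq C D hC hD =>
    simp only [WF, Bool.and_eq_true] at h
    obtain ⟨t, ht, htle⟩ := hC h.1 s
    obtain ⟨t', ht', htle'⟩ := hD h.2 (C.run s)
    rw [(frame_run C s).var 0 (setsVar_zero h.1)] at htle'
    exact ⟨_, Exec.seq ht ht', by rw [time, Polynomial.eval_add]; omega⟩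
  | ite e C D hC hD =>
    simp only [WF, Bool.and_eq_true] at h
    simp only [time, Polynomial.eval_add, Polynomial.eval_C]
    by_cases he : e.eval s = 0
    · obtain ⟨t, ht, htle⟩ := hD h.2 s
      rw [run, if_neg (not_not.2 he)]
      exact ⟨_, Exec.ite_false he ht, by omega⟩
    · obtain ⟨t, ht, htle⟩ := hC h.1 s
      rw [run, if_pos he]
      exact ⟨_, Exec.ite_true he ht, by omega⟩
  | forLt x C hC =>
    obtain ⟨hWF, -, hx0⟩ := wf_forLt h
    have hn : (s.setVar x 0).var 0 = s.var 0 := by rw [setVar_var, if_neg hx0.symm]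
    obtain ⟨t, ht, htle⟩ := exec_loop h (hC hWF) (s.var 0) (s.setVar x 0) (by
      rw [hn, setVar_var, if_pos rfl]; rfl)
    rw [hn] at htle
    refine ⟨_, Exec.seq (Exec.assign s x (.const 0)) ht, ?_⟩
    simp only [time, Polynomial.eval_add, Polynomial.eval_mul, Polynomial.eval_X,
      Polynomial.eval_C, Expr.cost]
    omega

end Code

end RAM

namespace RAM

/-- An expression that is not zero if and only if `e` and `f` differ. -/
def Expr.ne (e f : Expr) : Expr := .add (.sub e f) (.sub f e)

lemma Expr.eval_ne {e f : Expr} {s : State} : (Expr.ne e f).eval s ≠ 0 ↔ e.eval s ≠ f.eval s := by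
  simp only [Expr.ne, Expr.eval]
  omega

lemma Expr.eval_sub {e f : Expr} {s : State} :
    (Expr.sub e f).eval s ≠ 0 ↔ f.eval s < e.eval s := by
  simp only [Expr.eval]
  omega

end RAM

/- Arrays `0` and `1` are the input and the output. Array `2` holds the products `i * n`, since the
machine cannot multiply, array `3` the rank of `j` on the list of `i` in cell `i * n + j`, arrays
`4` and `5` a permutation and its inverse, and arrays `6` and `7` the second choice of every agent
and the agent that it displaces. Variable `0` is `n`, and the other variables are scratch. -/

namespace Roommates

open RAM RAM.Code

section RankTable

variable {n : ℕ} {I : Roommates n} {C : Code} {s u : State} {i j : Fin n}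

/-- The table of preference lists is in memory, together with the starts of its rows. -/
structure HoldsInput (I : Roommates n) (s : State) : Prop where
  card : s.var 0 = n
  input : s.arr 0 = I.inputCell
  row : ∀ i : Fin n, s.arr 2 i = i * n

lemma HoldsInput.of_frame (h : HoldsInput I s) (hf : C.Frame s u) (h0 : C.setsVar 0 = false)
    (ha : ∀ a ∈ [0, 2], C.setsArr a = false) : HoldsInput I u where
  card := (hf.var 0 h0).trans h.card
  input := (hf.arr 0 (ha 0 (by simp))).trans h.input
  row i := (congrFun (hf.arr 2 (ha 2 (by simp))) i).trans (h.row i)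

def rowsBody : Code := .seq (.write 2 (.var 1) (.var 2)) (.assign 2 (.add (.var 2) (.var 0)))

def rows : Code := .seq (.assign 2 (.const 0)) (.forLt 1 rowsBody)

lemma run_rows (I : Roommates n) : HoldsInput I (rows.run I.inputState) := by
  have hf := frame_run rows I.inputState
  refine ⟨hf.var 0 rfl, hf.arr 0 rfl, fun i => ?_⟩
  refine (run_forLt (x := 1) (C := rowsBody) (s := I.inputState.setVar 2 0) (n := n) rfl
    (fun k u => u.var 2 = k * n ∧ ∀ i : Fin n, (i : ℕ) < k → u.arr 2 i = i * n)
    ⟨by simp [setVar_var], fun i hi => absurd hi (Nat.not_lt_zero _)⟩ ?_).2 i i.2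
  rintro k u hf h1 ⟨h2, hrow⟩
  have h0 : u.var 0 = n := hf.var 0 rfl
  refine ⟨?_, (forall_lt_succ_iff k).2 ⟨?_, fun j hj => ?_⟩⟩
  · simp [rowsBody, run, Expr.eval, setVar_var, setArr_var, h0, h2, add_mul]
  · simp [rowsBody, run, Expr.eval, setVar_arr, setArr_arr, h1, h2]
  · simp [rowsBody, run, Expr.eval, setVar_arr, setArr_arr, h1, hj.ne, hrow j hj]

lemma inputCell_eq_iff (I : Roommates n) (i j : Fin n) {r : ℕ} (hr : r < n) :
    I.inputCell (i * n + r) = j + 1 ↔ I.rank i j = r + 1 := by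
  have hn : 0 < n := i.pos
  have hdiv : (i * n + r) / n = i := by
    rw [mul_comm, Nat.mul_add_div hn, Nat.div_eq_of_lt hr, add_zero]
  have hmod : (i * n + r) % n = r := by
    rw [mul_comm, Nat.mul_add_mod, Nat.mod_eq_of_lt hr]
  have hcell : I.inputCell (i * n + r) = j + 1 ↔ (I.pref i)[r]? = some j := by
    simp only [inputCell, hdiv, hmod, i.2, dif_pos, Fin.eta]
    cases (I.pref i)[r]? <;> simp [Fin.val_inj]
  rw [hcell]
  constructor
  · intro h
    obtain ⟨hlt, rfl⟩ := List.getElem?_eq_some_iff.1 h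
    rw [rank, if_pos (List.getElem_mem hlt), (I.nodup i).idxOf_getElem r hlt]
  · intro h
    have hj : j ∈ I.pref i := I.rank_le_iff.1 (by omega)
    rw [rank, if_pos hj, Nat.add_right_cancel_iff] at h
    subst h
    rw [List.getElem?_eq_getElem (List.idxOf_lt_length_of_mem hj), List.getElem_idxOf]

def findPosBody : Code :=
  .ite (.ne (.read 0 (.add (.read 2 (.var 1)) (.var 3))) (.add (.var 2) (.const 1)))
    .skip (.assign 4 (.add (.var 3) (.const 1)))

def findPos : Code := .seq (.assign 4 (.add (.var 0) (.const 1))) (.forLt 3 findPosBody)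

lemma run_findPos (h : HoldsInput I s) (h1 : s.var 1 = i) (h2 : s.var 2 = j) :
    (findPos.run s).var 4 = I.rank i j := by
  have h4 : (forLt 3 findPosBody).run (s.setVar 4 (s.var 0 + 1)) = findPos.run s := rfl
  have hs : HoldsInput I (s.setVar 4 (s.var 0 + 1)) :=
    h.of_frame (frame_run (.assign 4 (.add (.var 0) (.const 1))) s) rfl (by decide)
  have hpos := run_forLt (x := 3) (C := findPosBody) hs.card
    (fun k u => u.var 4 = if I.rank i j ≤ k then I.rank i j else n + 1)
    (by simp [setVar_var, h.card, (I.rank_pos i j).ne']) fun k u hf h3 hinv => by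
      have hu := hs.of_frame hf rfl (by decide)
      have e1 : u.var 1 = i := (hf.var 1 rfl).trans h1
      have e2 : u.var 2 = j := (hf.var 2 rfl).trans h2
      simp only [findPosBody, run, Expr.eval_ne, Expr.eval, e1, e2, h3, hu.input, hu.row, ne_eq,
        I.inputCell_eq_iff i j k.2, setVar_var]
      by_cases hk : I.rank i j = k + 1
      · simp [hk, setVar_var]
      · simp [hk, hinv, Nat.le_succ_iff]
  rw [h4] at hpos
  rw [hpos]
  have := I.rank_le i j
  split_ifs <;> omega

def rankCell : Code := .seq findPos (.write 3 (.add (.read 2 (.var 1)) (.var 2)) (.var 4))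

lemma run_rankCell (h : HoldsInput I s) (h1 : s.var 1 = i) (h2 : s.var 2 = j) (m : ℕ) :
    (rankCell.run s).arr 3 m = if m = i * n + j then I.rank i j else s.arr 3 m := by
  have hf := frame_run findPos s
  have hu := h.of_frame hf rfl (by decide)
  have e1 : (findPos.run s).var 1 = i := (hf.var 1 rfl).trans h1
  have e2 : (findPos.run s).var 2 = j := (hf.var 2 rfl).trans h2
  have e3 : (findPos.run s).arr 3 = s.arr 3 := hf.arr 3 rfl
  simp only [rankCell, run, Expr.eval, setArr_arr, e1, e2, e3, hu.row, run_findPos h h1 h2,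
    true_and]

def rankRow : Code := .forLt 2 rankCell

lemma run_rankRow (h : HoldsInput I s) (h1 : s.var 1 = i) (j : Fin n) :
    (rankRow.run s).arr 3 (i * n + j) = I.rank i j := by
  refine run_forLt_forall h.card (fun j a => a 3 (i * n + j) = I.rank i j)
    (fun j u hf h2 => ?_) (fun k u hf h2 j hj hinv => ?_) j
  · rw [run_rankCell (h.of_frame hf rfl (by decide)) ((hf.var 1 rfl).trans h1) h2, if_pos rfl]
  · rw [run_rankCell (h.of_frame hf rfl (by decide)) ((hf.var 1 rfl).trans h1) h2, if_neg, hinv]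
    have := Fin.lt_def.1 hj
    omega

lemma run_rankRow_of_lt (h : HoldsInput I s) (h1 : s.var 1 = i) {m : ℕ} (hm : m < i * n) :
    (rankRow.run s).arr 3 m = s.arr 3 m := by
  refine run_forLt h.card (fun _ u => u.arr 3 m = s.arr 3 m) rfl fun k u hf h2 hinv => ?_
  rw [setVar_arr,
    run_rankCell (h.of_frame hf rfl (by decide)) ((hf.var 1 rfl).trans h1) h2, if_neg, hinv]
  omega

/-- The rank table is in memory. -/
structure HoldsRanks (I : Roommates n) (s : State) : Prop extends HoldsInput I s where
  rank : ∀ i j : Fin n, s.arr 3 (i * n + j) = I.rank i j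

lemma HoldsRanks.of_frame (h : HoldsRanks I s) (hf : C.Frame s u) (h0 : C.setsVar 0 = false)
    (ha : ∀ a ∈ [0, 2, 3], C.setsArr a = false) : HoldsRanks I u where
  toHoldsInput := h.toHoldsInput.of_frame hf h0 fun a h' => ha a (List.mem_append_left [3] h')
  rank i j := (congrFun (hf.arr 3 (ha 3 (by simp))) _).trans (h.rank i j)

def rankTable : Code := .forLt 1 rankRow

lemma run_rankTable (h : HoldsInput I s) : HoldsRanks I (rankTable.run s) where
  toHoldsInput := h.of_frame (frame_run rankTable s) rfl (by decide)
  rank i := by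
    refine run_forLt_forall h.card (fun i a => ∀ j : Fin n, a 3 (i * n + j) = I.rank i j)
      (fun i u hf h1 => run_rankRow (h.of_frame hf rfl (by decide)) h1)
      (fun k u hf h1 i hi hinv j => ?_) i
    have hlt : i * n + j < k * n :=
      calc i * n + j < i * n + n := Nat.add_lt_add_left j.2 _
        _ = (i + 1) * n := (Nat.succ_mul _ _).symm
        _ ≤ k * n := Nat.mul_le_mul_right n (Nat.succ_le_of_lt hi)
    rw [run_rankRow_of_lt (h.of_frame hf rfl (by decide)) h1 hlt, hinv j]

end RankTable

section SecondChoice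

variable {n : ℕ} {I : Roommates n} {σ : Equiv.Perm (Fin n)} {f : Fin n → Fin n} {C : Code}
  {s u : State} {x j q : Fin n}

/-- The permutation `σ` and its inverse are in memory. -/
structure HoldsPerm (I : Roommates n) (σ : Equiv.Perm (Fin n)) (s : State) : Prop
    extends HoldsRanks I s where
  succ : ∀ i : Fin n, s.arr 4 i = σ i
  pred : ∀ i : Fin n, s.arr 5 i = (σ⁻¹ i : Fin n)

lemma HoldsPerm.of_frame (h : HoldsPerm I σ s) (hf : C.Frame s u) (h0 : C.setsVar 0 = false)
    (ha : ∀ a ∈ [0, 2, 3, 4, 5], C.setsArr a = false) : HoldsPerm I σ u where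
  toHoldsRanks := h.toHoldsRanks.of_frame hf h0 fun a h' => ha a (List.mem_append_left [4, 5] h')
  succ i := (congrFun (hf.arr 4 (ha 4 (by simp))) i).trans (h.succ i)
  pred i := (congrFun (hf.arr 5 (ha 5 (by simp))) i).trans (h.pred i)

def initPermBody : Code := .seq (.write 4 (.var 1) (.var 1)) (.write 5 (.var 1) (.var 1))

def initPerm : Code := .forLt 1 initPermBody

lemma run_initPerm (h : HoldsRanks I s) : HoldsPerm I 1 (initPerm.run s) := by
  have hrun := run_forLt_forall (x := 1) (C := initPermBody) h.card
    (fun i a => a 4 i = i ∧ a 5 i = i)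
    (fun k u _ h1 => by
      simp [initPermBody, run, Expr.eval, setArr_var, setArr_arr, h1])
    (fun k u _ h1 i hi hinv => by
      simp [initPermBody, run, Expr.eval, setArr_var, setArr_arr, h1, Fin.val_ne_of_ne hi.ne,
        hinv])
  exact ⟨h.of_frame (frame_run initPerm s) rfl (by decide), fun i => (hrun i).1,
    fun i => (hrun i).2⟩

/-- The cell of the rank table for the agents `e` and `f`. -/
def rankExpr (e f : Expr) : Expr := .read 3 (.add (.read 2 e) f)

lemma HoldsRanks.eval_rankExpr (h : HoldsRanks I s) {e f : Expr} {i j : Fin n}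
    (he : e.eval s = i) (hf : f.eval s = j) : (rankExpr e f).eval s = I.rank i j := by
  simp only [rankExpr, Expr.eval, he, hf, h.row, h.rank]

def setTop : Code :=
  .ite (.ne (.read 4 (.var 1)) (.var 1))
    (.assign 4 (rankExpr (.var 1) (.read 4 (.var 1)))) (.assign 4 (.const 0))

lemma run_setTop (h : HoldsPerm I σ s) (h1 : s.var 1 = x) :
    (setTop.run s).var 4 = I.top σ x := by
  have hsucc : (Expr.read 4 (.var 1)).eval s = σ x := by simp only [Expr.eval, h1, h.succ]
  have hvar : (Expr.var 1).eval s = x := h1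
  simp only [setTop, run, Expr.eval_ne, hsucc, hvar, h.eval_rankExpr hvar hsucc, top, ne_eq,
    Fin.val_inj]
  split_ifs <;> simp [setVar_var, Expr.eval]

def tryCand : Code :=
  .ite (.sub (rankExpr (.var 1) (.var 2)) (.var 4))
    (.ite (.sub (rankExpr (.var 2) (.read 5 (.var 2))) (rankExpr (.var 2) (.var 1)))
      (.ite (.sub (rankExpr (.var 1) (.var 3)) (rankExpr (.var 1) (.var 2)))
        (.assign 3 (.var 2)) .skip) .skip) .skip

lemma IsCand.of_rank_le (hle : I.rank x j ≤ n) (htop : I.top σ x < I.rank x j)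
    (hbot : I.rank j x < I.bot σ j) : I.IsCand σ x j :=
  ⟨I.edge_iff.2 ⟨hle, Nat.lt_succ_iff.1 (hbot.trans_le (bot_le j))⟩, htop, hbot⟩

lemma run_tryCand (h : HoldsPerm I σ s) (h1 : s.var 1 = x) (h2 : s.var 2 = j) (h3 : s.var 3 = q)
    (h4 : s.var 4 = I.top σ x) :
    ∃ q' : Fin n, (tryCand.run s).var 3 = q' ∧ (I.IsCand σ x q' ∨ q' = q) ∧
      I.rank x q' ≤ I.rank x q ∧ (I.IsCand σ x j → I.rank x q' ≤ I.rank x j) := by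
  have hpred : (Expr.read 5 (.var 2)).eval s = (σ⁻¹ j : Fin n) := by
    simp only [Expr.eval, h2, h.pred]
  simp only [tryCand, run, Expr.eval_sub, h.eval_rankExpr (e := .var 1) (f := .var 2) h1 h2,
    h.eval_rankExpr (e := .var 2) (f := .var 1) h2 h1, h.eval_rankExpr (e := .var 2) h2 hpred,
    h.eval_rankExpr (e := .var 1) (f := .var 3) h1 h3]
  simp only [Expr.eval, h4]
  split_ifs with htop hbot hlt
  · have hle : I.rank x j ≤ n := Nat.lt_succ_iff.1 (hlt.trans_le (I.rank_le x q))
    exact ⟨j, by simp [setVar_var, h2], .inl (.of_rank_le hle htop hbot), hlt.le, fun _ => le_rfl⟩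
  · exact ⟨q, h3, .inr rfl, le_rfl, fun _ => not_lt.1 hlt⟩
  · exact ⟨q, h3, .inr rfl, le_rfl, fun hj => absurd hj.lt_bot hbot⟩
  · exact ⟨q, h3, .inr rfl, le_rfl, fun hj => absurd hj.top_lt htop⟩

def bestCand : Code := .seq (.assign 3 (.var 1)) (.forLt 2 tryCand)

lemma run_bestCand (h : HoldsPerm I σ s) (h1 : s.var 1 = x) (h4 : s.var 4 = I.top σ x) :
    ∃ q : Fin n, (bestCand.run s).var 3 = q ∧ I.IsSecond σ x q := by
  have hs : HoldsPerm I σ (s.setVar 3 (s.var 1)) :=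
    h.of_frame (frame_run (.assign 3 (.var 1)) s) rfl (by decide)
  obtain ⟨q, h3, hq, hle⟩ := run_forLt (x := 2) (C := tryCand) hs.card
    (fun k u => ∃ q : Fin n, u.var 3 = q ∧ (I.IsCand σ x q ∨ q = x) ∧
      ∀ j : Fin n, (j : ℕ) < k → I.IsCand σ x j → I.rank x q ≤ I.rank x j)
    ⟨x, by simp [setVar_var, h1], .inr rfl, fun j hj => absurd hj (Nat.not_lt_zero _)⟩ <| by
      rintro k u hf h2 ⟨q, h3, hq, hle⟩
      obtain ⟨q', h3', hq', hle', hk⟩ := run_tryCand (hs.of_frame hf rfl (by decide))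
        ((hf.var 1 rfl).trans h1) h2 h3 ((hf.var 4 rfl).trans h4)
      refine ⟨q', by simp [setVar_var, h3'], hq'.elim .inl fun h' => h' ▸ hq,
        (forall_lt_succ_iff k).2 ⟨hk, fun j hj hc => hle'.trans (hle j hj hc)⟩⟩
  exact ⟨q, h3, hq, fun j => hle j j.2⟩

def secondBody : Code :=
  .seq setTop (.seq bestCand
    (.seq (.write 6 (.var 1) (.var 3)) (.write 7 (.var 1) (.read 5 (.var 3)))))

lemma run_secondBody (h : HoldsPerm I σ s) (h1 : s.var 1 = x) :
    ∃ q : Fin n, I.IsSecond σ x q ∧ ∀ y,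
      (secondBody.run s).arr 6 y = (if y = x then (q : ℕ) else s.arr 6 y) ∧
      (secondBody.run s).arr 7 y = if y = x then ((σ⁻¹ q : Fin n) : ℕ) else s.arr 7 y := by
  have htop := frame_run setTop s
  have hu := h.of_frame htop rfl (by decide)
  obtain ⟨q, h3, hq⟩ := run_bestCand hu ((htop.var 1 rfl).trans h1) (run_setTop h h1)
  have hf : (seq setTop bestCand).Frame s (bestCand.run (setTop.run s)) := frame_run _ s
  have e1 : (bestCand.run (setTop.run s)).var 1 = x := (hf.var 1 rfl).trans h1
  have e5 := (h.of_frame hf rfl (by decide)).pred q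
  have e6 : (bestCand.run (setTop.run s)).arr 6 = s.arr 6 := hf.arr 6 rfl
  have e7 : (bestCand.run (setTop.run s)).arr 7 = s.arr 7 := hf.arr 7 rfl
  refine ⟨q, hq, fun y => ?_⟩
  simp [secondBody, run, Expr.eval, setArr_arr, setArr_var, e1, h3, e5, e6, e7]

/-- The permutation `σ`, the second choices `f` and the agents displaced by them are in memory. -/
structure HoldsSeconds (I : Roommates n) (σ : Equiv.Perm (Fin n)) (f : Fin n → Fin n) (s : State) :
    Prop extends HoldsPerm I σ s where
  second : ∀ x : Fin n, s.arr 6 x = f x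
  displaced : ∀ x : Fin n, s.arr 7 x = displaced σ f x

lemma HoldsSeconds.of_frame (h : HoldsSeconds I σ f s) (hf : C.Frame s u)
    (h0 : C.setsVar 0 = false) (ha : ∀ a ∈ [0, 2, 3, 4, 5, 6, 7], C.setsArr a = false) :
    HoldsSeconds I σ f u where
  toHoldsPerm := h.toHoldsPerm.of_frame hf h0 fun a h' => ha a (List.mem_append_left [6, 7] h')
  second i := (congrFun (hf.arr 6 (ha 6 (by simp))) i).trans (h.second i)
  displaced i := (congrFun (hf.arr 7 (ha 7 (by simp))) i).trans (h.displaced i)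

def seconds : Code := .forLt 1 secondBody

lemma run_seconds (h : HoldsPerm I σ s) :
    ∃ f : Fin n → Fin n, (∀ x, I.IsSecond σ x (f x)) ∧ HoldsSeconds I σ f (seconds.run s) := by
  have hrun := run_forLt_forall (x := 1) (C := secondBody) h.card
    (fun x a => ∃ q : Fin n, I.IsSecond σ x q ∧ a 6 x = q ∧ a 7 x = (σ⁻¹ q : Fin n))
    (fun k u hf h1 => by
      obtain ⟨q, hq, harr⟩ := run_secondBody (h.of_frame hf rfl (by decide)) h1
      exact ⟨q, hq, by rw [(harr k).1, if_pos rfl], by rw [(harr k).2, if_pos rfl]⟩)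
    (fun k u hf h1 x hx hinv => by
      obtain ⟨_, _, harr⟩ := run_secondBody (h.of_frame hf rfl (by decide)) h1
      simpa only [(harr x).1, (harr x).2, if_neg (Fin.val_ne_of_ne hx.ne)] using hinv)
  choose f hf hf6 hf7 using hrun
  exact ⟨f, hf, h.of_frame (frame_run seconds s) rfl (by decide), hf6, hf7⟩

end SecondChoice

section Elimination

variable {n : ℕ} {I : Roommates n} {σ σ' : Equiv.Perm (Fin n)} {f : Fin n → Fin n} {s : State}
  {x p : Fin n}

def findBody : Code :=
  .ite (.sub (rankExpr (.var 1) (.read 5 (.var 1))) (rankExpr (.var 1) (.read 6 (.var 1))))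
    (.assign 3 (.var 1)) .skip

def findStart : Code := .seq (.assign 3 (.var 0)) (.forLt 1 findBody)

lemma run_findBody (h : HoldsSeconds I σ f s) (h1 : s.var 1 = x) :
    findBody.run s = if I.rank x (f x) < I.bot σ x then s.setVar 3 x else s := by
  have hsecond : (Expr.read 6 (.var 1)).eval s = f x := by simp only [Expr.eval, h1, h.second]
  have hpred : (Expr.read 5 (.var 1)).eval s = (σ⁻¹ x : Fin n) := by
    simp only [Expr.eval, h1, h.pred]
  have hvar : (Expr.var 1).eval s = x := h1
  simp only [findBody, run, Expr.eval_sub, h.eval_rankExpr hvar hpred,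
    h.eval_rankExpr hvar hsecond, hvar]
  rfl

lemma run_findStart (h : HoldsSeconds I σ f s) :
    ((findStart.run s).var 3 = n ∧ ∀ x, I.bot σ x ≤ I.rank x (f x)) ∨
      ∃ x : Fin n, (findStart.run s).var 3 = x ∧ I.rank x (f x) < I.bot σ x := by
  have hs : HoldsSeconds I σ f (s.setVar 3 (s.var 0)) :=
    h.of_frame (frame_run (.assign 3 (.var 0)) s) rfl (by decide)
  have hrun := run_forLt (x := 1) (C := findBody) hs.card
    (fun k u => (u.var 3 = n ∧ ∀ x : Fin n, (x : ℕ) < k → I.bot σ x ≤ I.rank x (f x)) ∨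
      ∃ x : Fin n, u.var 3 = x ∧ I.rank x (f x) < I.bot σ x)
    (.inl ⟨by simp [setVar_var, h.card], fun j hj => absurd hj (Nat.not_lt_zero _)⟩)
    fun k u hf h1 hinv => by
      rw [run_findBody (hs.of_frame hf rfl (by decide)) h1]
      split_ifs with hk
      · exact .inr ⟨k, by simp [setVar_var], hk⟩
      · exact hinv.imp (fun ⟨h3, hle⟩ => ⟨h3, (forall_lt_succ_iff k).2 ⟨not_lt.1 hk, hle⟩⟩) id
  exact hrun.imp_left fun ⟨h3, hle⟩ => ⟨h3, fun x => hle x x.2⟩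

def walkBody : Code := .assign 3 (.read 7 (.var 3))

/-- Moving on `n` times along the displaced agents, which surely ends on a cycle of that map. -/
def walk : Code := .forLt 1 walkBody

lemma run_walk (h : HoldsSeconds I σ f s) (h3 : s.var 3 = x) :
    (walk.run s).var 3 = (Roommates.displaced σ f)^[n] x := by
  refine run_forLt h.card (fun k u => u.var 3 = (Roommates.displaced σ f)^[k] x) h3
    fun k u hf _ hinv => ?_
  have hu := h.of_frame hf rfl (by decide)
  simp [walkBody, run, Expr.eval, setVar_var, hinv, hu.displaced, Function.iterate_succ_apply']

def eliminateBody : Code :=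
  .seq (.write 4 (.var 3) (.read 6 (.var 3)))
    (.seq (.write 5 (.read 6 (.var 3)) (.var 3)) (.assign 3 (.read 7 (.var 3))))

/-- Goes around the cycle that `walk` has reached. A cycle of length less than `n` is traversed
again, which is harmless because the moves only depend on the unchanged arrays `6` and `7`. -/
def eliminate : Code := .forLt 1 eliminateBody

lemma run_eliminateBody (h6 : s.arr 6 x = f x) (h7 : s.arr 7 x = Roommates.displaced σ f x)
    (h3 : s.var 3 = x) (y : ℕ) :
    (eliminateBody.run s).var 3 = Roommates.displaced σ f x ∧
      (eliminateBody.run s).arr 4 y = (if y = x then (f x : ℕ) else s.arr 4 y) ∧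
      (eliminateBody.run s).arr 5 y = if y = f x then (x : ℕ) else s.arr 5 y := by
  simp [eliminateBody, run, Expr.eval, setVar_var, setVar_arr, setArr_var, setArr_arr, h3, h6, h7]

lemma run_eliminate (h : HoldsSeconds I σ f s) (h3 : s.var 3 = p)
    (hmem : ∀ k, σ' ((Roommates.displaced σ f)^[k] p) = f ((Roommates.displaced σ f)^[k] p))
    (hnotMem : ∀ y, (∀ k < n, y ≠ (Roommates.displaced σ f)^[k] p) → σ' y = σ y) :
    HoldsPerm I σ' (eliminate.run s) := by
  obtain ⟨-, hdone⟩ := run_forLt (x := 1) (C := eliminateBody) h.card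
    (fun k u => u.var 3 = (Roommates.displaced σ f)^[k] p ∧
      ∀ y : Fin n, (∀ m, k ≤ m → m < n → y ≠ (Roommates.displaced σ f)^[m] p) →
        u.arr 4 y = σ' y ∧ u.arr 5 (σ' y) = y)
    ⟨h3, fun y hy => by
      rw [hnotMem y fun m => hy m m.zero_le, setVar_arr, h.succ, h.pred, perm_inv_apply_self]
      exact ⟨rfl, rfl⟩⟩ fun k u hf _ ⟨hvar, hinv⟩ => by
      have h6 := (congrFun (hf.arr 6 rfl) _).trans (h.second ((Roommates.displaced σ f)^[k] p))
      have h7 := (congrFun (hf.arr 7 rfl) _).trans (h.displaced ((Roommates.displaced σ f)^[k] p))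
      have hbody := run_eliminateBody h6 h7 hvar
      refine ⟨?_, fun y hy => ?_⟩
      · rw [setVar_var, if_neg (by decide), (hbody 0).1, Function.iterate_succ_apply']
      · rw [setVar_arr, (hbody y).2.1, (hbody (σ' y)).2.2, ← hmem k]
        simp only [Fin.val_inj, σ'.injective.eq_iff]
        split_ifs with hyk
        · exact ⟨by rw [hyk], by rw [hyk]⟩
        · refine hinv y fun m hkm hm => ?_
          rcases hkm.eq_or_lt with rfl | hlt
          · exact hyk
          · exact hy m hlt hm
  have harr := fun y => hdone y fun m hnm hm => absurd hm hnm.not_gt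
  refine ⟨h.toHoldsRanks.of_frame (frame_run eliminate s) rfl (by decide),
    fun y => (harr y).1, fun y => ?_⟩
  have hpred := (harr (σ'⁻¹ y)).2
  rwa [perm_apply_inv_self] at hpred

def rotate : Code := .ite (.sub (.var 0) (.var 3)) (.seq walk eliminate) .skip

lemma run_rotate_of_eq (h : HoldsSeconds I σ f s) (h3 : s.var 3 = n) : rotate.run s = s := by
  simp [rotate, run, Expr.eval, h.card, h3]

lemma run_rotate (h : HoldsSeconds I σ f s) (hσ : I.IsSemistable σ)
    (hs : ∀ x, I.IsSecond σ x (f x)) (h3 : s.var 3 = x) (hx : I.rank x (f x) < I.bot σ x) :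
    ∃ σ', I.IsSemistable σ' ∧ HoldsPerm I σ' (rotate.run s) ∧
      ∑ x, I.top σ x < ∑ x, I.top σ' x := by
  have hrun : rotate.run s = eliminate.run (walk.run s) := by
    rw [rotate, run, if_pos (Expr.eval_sub.2 _)]
    · rfl
    · simp only [Expr.eval, h.card, h3, x.2]
  have hZ := hσ.isRotation_range_iterate hs hx
  refine ⟨hZ.eliminate, hZ.isSemistable_eliminate hσ hs, ?_,
    hZ.sum_top_lt hσ hs (Set.range_nonempty _)⟩
  rw [hrun]
  refine run_eliminate (h.of_frame (frame_run walk s) rfl (by decide)) (run_walk h h3)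
    (fun k => hZ.eliminate_of_mem ⟨k, rfl⟩) fun y hy => hZ.eliminate_of_notMem ?_
  rintro ⟨m, rfl⟩
  have hp := iterate_card_mem_periodicPts (Roommates.displaced σ f) x
  rw [Fintype.card_fin] at hp
  obtain ⟨k, hk, hkm⟩ := exists_lt_card_iterate_eq hp m
  exact hy k (hk.trans_eq (Fintype.card_fin n)) hkm.symm

def round : Code := .seq seconds (.seq findStart rotate)

lemma run_round (h : HoldsPerm I σ s) (hσ : I.IsSemistable σ) :
    ∃ σ', I.IsSemistable σ' ∧ HoldsPerm I σ' (round.run s) ∧ (I.IsStablePartition σ' ∨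
      ¬ I.IsStablePartition σ ∧ ∑ x, I.top σ x < ∑ x, I.top σ' x) := by
  obtain ⟨f, hf, hs⟩ := run_seconds h
  have hu : HoldsSeconds I σ f (findStart.run (seconds.run s)) :=
    hs.of_frame (frame_run findStart _) rfl (by decide)
  have hrun : round.run s = rotate.run (findStart.run (seconds.run s)) := rfl
  rw [hrun]
  rcases run_findStart hs with ⟨h3, hle⟩ | ⟨x, h3, hlt⟩
  · rw [run_rotate_of_eq hu h3]
    exact ⟨σ, hσ, hu.toHoldsPerm, .inl (hσ.isStablePartition hf hle)⟩
  · obtain ⟨σ', hσ', hrot, hsum⟩ := run_rotate hu hσ hf h3 hlt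
    exact ⟨σ', hσ', hrot, .inr ⟨fun hst => (hst.bot_le_rank_second (hf x)).not_gt hlt, hsum⟩⟩

/-- The permutation in memory is a stable partition, or at least `m` rotations have been
eliminated, each of which has increased the sum of the ranks of the successors. -/
def Progress (I : Roommates n) (m : ℕ) (s : State) : Prop :=
  ∃ σ, I.IsSemistable σ ∧ HoldsPerm I σ s ∧ (I.IsStablePartition σ ∨ m ≤ ∑ x, I.top σ x)

lemma Progress.setVar {m y : ℕ} (h : Progress I m s) (hy : y ≠ 0) (v : ℕ) :
    Progress I m (s.setVar y v) := by
  obtain ⟨σ, hσ, hs, hm⟩ := h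
  have hvar : (assign y (.const v)).setsVar 0 = false := by simpa [setsVar] using hy
  exact ⟨σ, hσ, hs.of_frame (frame_run (.assign y (.const v)) s) hvar fun _ _ => rfl, hm⟩

lemma Progress.round {m : ℕ} (h : Progress I m s) : Progress I (m + 1) (round.run s) := by
  obtain ⟨σ, hσ, hs, hm⟩ := h
  obtain ⟨σ', hσ', hs', hst | ⟨hnst, hlt⟩⟩ := run_round hs hσ
  · exact ⟨σ', hσ', hs', .inl hst⟩
  · exact ⟨σ', hσ', hs', .inr ((hm.resolve_left hnst).trans_lt hlt)⟩

lemma Progress.exists_isStablePartition (h : Progress I (n * n + 1) s) :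
    ∃ σ, I.IsStablePartition σ ∧ HoldsPerm I σ s := by
  obtain ⟨σ, hσ, hs, hm⟩ := h
  refine ⟨σ, hm.resolve_right fun hle => ?_, hs⟩
  have hsum : ∑ x, I.top σ x ≤ n * n := by
    simpa using Finset.sum_le_card_nsmul Finset.univ (I.top σ) n fun x _ => hσ.top_le_card x
  omega

/-- As many as `n * n + 1` rounds: the ranks of the successors add up to at most `n * n`, so there
is a round that does not find a rotation. -/
def rounds : Code := .seq (.forLt 10 (.forLt 11 round)) round

lemma run_rounds (h : HoldsPerm I 1 s) :
    ∃ σ, I.IsStablePartition σ ∧ HoldsPerm I σ (rounds.run s) := by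
  have hstart : Progress I (0 * n) s :=
    ⟨1, I.isSemistable_one, h, .inr ((Nat.zero_mul n).trans_le (Nat.zero_le _))⟩
  have hrun : Progress I (n * n) ((forLt 10 (forLt 11 round)).run s) :=
    run_forLt h.card (fun k u => Progress I (k * n) u) (hstart.setVar (by decide) _)
      fun k u hf _ hinv => by
        have hrow : Progress I (k * n + n) ((forLt 11 Roommates.round).run u) :=
          run_forLt ((hf.var 0 rfl).trans h.card) (fun m v => Progress I (k * n + m) v)
            (hinv.setVar (by decide) _) fun m v _ _ hinv => hinv.round.setVar (by decide) _
        rw [Nat.succ_mul]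
        exact hrow.setVar (by decide) _
  exact hrun.round.exists_isStablePartition

end Elimination

section Output

variable {n : ℕ} {I : Roommates n} {σ : Equiv.Perm (Fin n)} {b : Fin n → Fin n} {d : Fin n → ℕ}
  {s : State} {x y : Fin n}

lemma exists_pow_eq_of_sameCycle (h : σ.SameCycle x y) : ∃ m ≤ n, (σ ^ m) x = y := by
  by_cases hx : σ x = x
  · exact ⟨0, n.zero_le, h.eq_of_left hx⟩
  · obtain ⟨m, hm, hpow⟩ := h.exists_pow_eq_of_mem_support (Equiv.Perm.mem_support.2 hx)
    refine ⟨m, hm.le.trans ?_, hpow⟩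
    simpa using Finset.card_le_univ (σ.cycleOf x).support

lemma IsCut.le_card (h : IsCut σ b d) (x : Fin n) : d x ≤ n := by
  obtain ⟨m, hm, hpow⟩ := exists_pow_eq_of_sameCycle (h.sameCycle x)
  exact (not_lt.1 fun hlt => h.min x m hlt hpow).trans hm

lemma HoldsPerm.succ_pow (h : HoldsPerm I σ s) (k : ℕ) (x : Fin n) :
    s.arr 4 ((σ ^ k) x : Fin n) = ((σ ^ (k + 1)) x : Fin n) := by
  rw [h.succ, pow_succ', Equiv.Perm.mul_apply]

def minBody : Code :=
  .seq (.assign 3 (.read 4 (.var 3))) (.ite (.sub (.var 2) (.var 3)) (.assign 2 (.var 3)) .skip)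

def cycleMin : Code := .seq (.assign 2 (.var 1)) (.seq (.assign 3 (.var 1)) (.forLt 4 minBody))

lemma run_minBody {k : ℕ} (h : HoldsPerm I σ s) (h3 : s.var 3 = ((σ ^ k) x : Fin n))
    (h2 : s.var 2 = y) :
    (minBody.run s).var 3 = ((σ ^ (k + 1)) x : Fin n) ∧
      (minBody.run s).var 2 = (min y ((σ ^ (k + 1)) x) : Fin n) := by
  have h4 := h.succ_pow k x
  rcases lt_or_ge ((σ ^ (k + 1)) x) y with hlt | hle
  · have hsub := Nat.sub_ne_zero_of_lt (Fin.lt_def.1 hlt)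
    simp [minBody, run, Expr.eval, setVar_var, h2, h3, h4, hlt.le, hsub]
  · simp [minBody, run, Expr.eval, setVar_var, h2, h3, h4, hle]

lemma run_cycleMin (h : HoldsPerm I σ s) (h1 : s.var 1 = x) :
    (cycleMin.run s).var 2 = leastInCycle σ x := by
  have hf := frame_run (seq (.assign 2 (.var 1)) (.assign 3 (.var 1))) s
  have hs := h.of_frame hf rfl (by decide)
  obtain ⟨-, y, h2, hxy, hle⟩ := run_forLt (x := 4) (C := minBody) hs.card
    (fun k u => u.var 3 = ((σ ^ k) x : Fin n) ∧
      ∃ y : Fin n, u.var 2 = y ∧ σ.SameCycle x y ∧ ∀ m ≤ k, y ≤ (σ ^ m) x)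
    ⟨by simp [run, Expr.eval, setVar_var, h1], x, by simp [run, Expr.eval, setVar_var, h1],
      .refl σ x, fun m hm => by rw [Nat.le_zero.1 hm]; rfl⟩ <| by
      rintro k u hf - ⟨h3, y, h2, hxy, hle⟩
      obtain ⟨h3', h2'⟩ := run_minBody (hs.of_frame hf rfl (by decide)) h3 h2
      refine ⟨h3', _, h2', ?_, fun m hm => ?_⟩
      · rcases min_choice y ((σ ^ ((k : ℕ) + 1)) x) with hmin | hmin <;> rw [hmin]
        · exact hxy
        · exact ⟨(k + 1 : ℕ), by rw [zpow_natCast]⟩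
      · rcases Nat.le_succ_iff.1 hm with hm | rfl
        · exact (min_le_left _ _).trans (hle m hm)
        · exact min_le_right _ _
  obtain ⟨m, hm, hpow⟩ := exists_pow_eq_of_sameCycle (sameCycle_leastInCycle σ x)
  have hyx : y = leastInCycle σ x := le_antisymm (hpow ▸ hle m hm) (leastInCycle_le hxy)
  rw [← hyx]
  exact h2

def parityBody : Code :=
  .ite (.ne (.var 3) (.var 1))
    (.seq (.assign 3 (.read 4 (.var 3))) (.assign 5 (.sub (.const 1) (.var 5)))) .skip

/-- Walks from the cut in variable `2` to the agent in variable `1`. -/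
def parity : Code := .seq (.assign 3 (.var 2)) (.seq (.assign 5 (.const 0)) (.forLt 4 parityBody))

lemma run_parityBody {k : ℕ} (h : HoldsPerm I σ s) (hb : IsCut σ b d) (h1 : s.var 1 = x)
    (h3 : s.var 3 = ((σ ^ min k (d x)) (b x) : Fin n)) (h5 : s.var 5 = min k (d x) % 2) :
    (parityBody.run s).var 3 = ((σ ^ min (k + 1) (d x)) (b x) : Fin n) ∧
      (parityBody.run s).var 5 = min (k + 1) (d x) % 2 := by
  have h4 := h.succ_pow k (b x)
  rcases lt_or_ge k (d x) with hk | hk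
  · rw [min_eq_left hk.le] at h3 h5
    rw [min_eq_left (Nat.succ_le_of_lt hk), parityBody, run, if_pos (Expr.eval_ne.2 _)]
    · simp only [run, Expr.eval, setVar_var, h3, h4, h5]
      simp only [Nat.reduceEqDiff, if_true, if_false, true_and]
      omega
    · simpa only [Expr.eval, h1, h3] using Fin.val_ne_of_ne (hb.min x k hk)
  · rw [min_eq_right hk] at h3 h5
    rw [min_eq_right (hk.trans k.le_succ), parityBody, run, if_neg (mt Expr.eval_ne.1 _)]
    · exact ⟨h3, h5⟩
    · simp [Expr.eval, h1, h3, hb.pow]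

lemma run_parity (h : HoldsPerm I σ s) (hb : IsCut σ b d) (h1 : s.var 1 = x)
    (h2 : s.var 2 = b x) : (parity.run s).var 5 = d x % 2 := by
  have hs := h.of_frame (frame_run (seq (.assign 3 (.var 2)) (.assign 5 (.const 0))) s) rfl
    (by decide)
  have hrun := run_forLt (x := 4) (C := parityBody) hs.card
    (fun k u => u.var 3 = ((σ ^ min k (d x)) (b x) : Fin n) ∧ u.var 5 = min k (d x) % 2)
    (by simp [run, Expr.eval, setVar_var, h2]) fun k u hf _ hinv =>
      run_parityBody (hs.of_frame hf rfl (by decide)) hb ((hf.var 1 rfl).trans h1) hinv.1 hinv.2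
  rw [min_eq_right (hb.le_card x)] at hrun
  exact hrun.2

def writePartner : Code :=
  .ite (.var 5) (.write 1 (.var 1) (.read 5 (.var 1)))
    (.ite (.ne (.read 4 (.var 1)) (.var 2)) (.write 1 (.var 1) (.read 4 (.var 1)))
      (.write 1 (.var 1) (.var 1)))

lemma run_writePartner (h : HoldsPerm I σ s) (h1 : s.var 1 = x) (h2 : s.var 2 = b x)
    (h5 : s.var 5 = d x % 2) (j : ℕ) :
    (writePartner.run s).arr 1 j =
      if j = x then ((pairUp σ b d x : Fin n) : ℕ) else s.arr 1 j := by
  have hodd : (Expr.var 5).eval s ≠ 0 ↔ Odd (d x) := by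
    rw [Nat.odd_iff, Expr.eval, h5]
    omega
  simp only [writePartner, run, hodd, Expr.eval_ne, pairUp]
  simp only [Expr.eval, h1, h2, h.succ, h.pred, ne_eq, Fin.val_inj]
  split_ifs <;> simp [setArr_arr, *]

def partnerBody : Code := .seq cycleMin (.seq parity writePartner)

lemma run_partnerBody (h : HoldsPerm I σ s) (hd : IsCut σ (leastInCycle σ) d) (h1 : s.var 1 = x)
    (j : ℕ) : (partnerBody.run s).arr 1 j =
      if j = x then ((pairUp σ (leastInCycle σ) d x : Fin n) : ℕ) else s.arr 1 j := by
  have hf := frame_run cycleMin s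
  have hf' := frame_run parity (cycleMin.run s)
  have hu := h.of_frame hf rfl (by decide)
  have e1 := (hf.var 1 rfl).trans h1
  have e2 := run_cycleMin h h1
  have e5 := run_parity hu hd e1 e2
  have harr : (parity.run (cycleMin.run s)).arr 1 = s.arr 1 := (hf'.arr 1 rfl).trans (hf.arr 1 rfl)
  rw [← harr]
  exact run_writePartner (hu.of_frame hf' rfl (by decide)) ((hf'.var 1 rfl).trans e1)
    ((hf'.var 2 rfl).trans e2) e5 j

def partners : Code := .forLt 1 partnerBody

lemma run_partners (h : HoldsPerm I σ s) (hd : IsCut σ (leastInCycle σ) d) (x : Fin n) :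
    (partners.run s).arr 1 x = pairUp σ (leastInCycle σ) d x := by
  refine run_forLt_forall h.card (fun x a => a 1 x = pairUp σ (leastInCycle σ) d x)
    (fun k u hf h1 => ?_) (fun k u hf h1 j hj hinv => ?_) x
  · rw [run_partnerBody (h.of_frame hf rfl (by decide)) hd h1, if_pos rfl]
  · rw [run_partnerBody (h.of_frame hf rfl (by decide)) hd h1, if_neg (Fin.val_ne_of_ne hj.ne),
      hinv]

end Output

/-- Computes the ranks of the agents, then a stable partition by eliminating rotations, and then
the pairing that arises when every cycle is cut just before its least agent. -/
def algorithm : Code := .seq rows (.seq rankTable (.seq initPerm (.seq rounds partners)))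

theorem run_algorithm {n : ℕ} (I : Roommates n) :
    ∃ (M : I.Matching) (π : Equiv.Perm (Fin n)) (D : Finset (Fin n)),
      Outputs (algorithm.run I.inputState) M ∧ I.IsStablePartition π ∧
        PicksOnePerOddCycle π D ∧ I.IsObtainedFrom π D M := by
  obtain ⟨π, hπ, hmem⟩ := run_rounds (run_initPerm (run_rankTable (run_rows I)))
  obtain ⟨d, hd⟩ := exists_isCut_leastInCycle π
  obtain ⟨D, hD, hb⟩ := hd.exists_picks
  exact ⟨hd.matching hπ.edge, π, D, run_partners hmem hd, hπ, hD,
    hd.isObtainedFrom hπ.edge hD hb⟩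

end Roommates

theorem mainTheorem4 :
    -- a `cn`-stable matching exists for every `c > 5/6`
    (∀ (n : ℕ) (I : Roommates n) (c : ℝ), 5 / 6 < c →
      ∃ M : I.Matching, I.IsKStable (c * n) M) ∧
    -- the construction can always be carried out ...
    (∀ (n : ℕ) (I : Roommates n), ∃ π : Equiv.Perm (Fin n), I.IsStablePartition π) ∧
    (∀ (n : ℕ) (I : Roommates n) (π : Equiv.Perm (Fin n)), I.IsStablePartition π →
      (∃ D : Finset (Fin n), Roommates.PicksOnePerOddCycle π D) ∧
      ∀ D : Finset (Fin n), Roommates.PicksOnePerOddCycle π D →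
        (∃ M : I.Matching, I.IsObtainedFrom π D M) ∧
        -- ... and at most `n/2 + x ≤ 5n/6` agents can improve on the matching that it gives
        ∀ M : I.Matching, I.IsObtainedFrom π D M →
          (∀ M' : I.Matching, ((I.improving M M').card : ℝ) ≤
            (n : ℝ) / 2 + ((Roommates.oddCycles π).card : ℝ)) ∧
          (n : ℝ) / 2 + ((Roommates.oddCycles π).card : ℝ) ≤ 5 * (n : ℝ) / 6 ∧
          ∀ c : ℝ, 5 / 6 < c → I.IsKStable (c * n) M) ∧
    -- one polynomial-time algorithm finds such a matching, which is good for all `c > 5/6`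
    (∃ (P : RAM.Prog) (p : Polynomial ℕ), ∀ (n : ℕ) (I : Roommates n),
      ∃ (M : I.Matching) (t : ℕ) (s : RAM.State),
        RAM.Exec P I.inputState t s ∧ t ≤ p.eval n ∧ Roommates.Outputs s M ∧
        (∃ (π : Equiv.Perm (Fin n)) (D : Finset (Fin n)), I.IsStablePartition π ∧
          Roommates.PicksOnePerOddCycle π D ∧ I.IsObtainedFrom π D M) ∧
        ∀ c : ℝ, 5 / 6 < c → I.IsKStable (c * n) M) := by
  refine ⟨fun n I c hc => ?_, fun n I => I.exists_isStablePartition, fun n I π hπ =>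
    ⟨Roommates.exists_picksOnePerOddCycle π, fun D hD => ⟨hD.exists_isObtainedFrom hπ.edge,
      fun M hM => ⟨hM.card_improving_le hπ hD, Roommates.half_add_card_oddCycles_le π,
        fun c hc => hM.isKStable hπ hD hc⟩⟩⟩,
    Roommates.algorithm.compile, Roommates.algorithm.time, fun n I => ?_⟩
  · obtain ⟨π, hπ⟩ := I.exists_isStablePartition
    obtain ⟨D, hD⟩ := Roommates.exists_picksOnePerOddCycle π
    obtain ⟨M, hM⟩ := hD.exists_isObtainedFrom hπ.edge
    exact ⟨M, hM.isKStable hπ hD hc⟩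
  · obtain ⟨M, π, D, hout, hπ, hD, hM⟩ := I.run_algorithm
    obtain ⟨t, hexec, ht⟩ := RAM.Code.exec_compile (C := Roommates.algorithm) rfl I.inputState
    exact ⟨M, t, _, hexec, ht, hout, ⟨π, D, hπ, hD, hM⟩, fun c hc => hM.isKStable hπ hD hc⟩
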